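/- Let $n \ge 2$ and let $q_0,\dots,q_{n+2}\in\mathbb{R}^2$ be the vertices of a convex $(n+3)$-gon $Q$ (each $q_i$ is a vertex of $Q=\operatorname{conv}\{q_0,\dots,q_{n+2}\}$). Let $$\mathrm{Ass}^{\mathrm I}_n(Q)=\operatorname{conv}\{v(t) : t \text{ a triangulation of } Q \text{ without new vertices}\}\subset\mathbb{R}^{n+3}$$ be the secondary polytope of $Q$, where $v(t)$ is the GKZ vector of $t$, whose $i$-th coordinate is the total area of the triangles of $t$ that have $q_i$ as a vertex. (1) $\mathrm{Ass}^{\mathrm I}_n(Q)$ is not affinely equivalent to any associahedron $\mathrm{Ass}^{\mathrm{II}}_n(A_n)$, that is, to any polytope $P$ in $\{x\in\mathbb{R}^{n+1}:\sum_i x_i=0\}$ whose normal fan is the fan with maximal cones $\mathbb{R}_{\ge0}C$, where $C$ runs over all clusters of type $A_n$. Here clusters are defined as follows. Let $\alpha_k=e_k-e_{k+1}$ $(1\le k\le n)$ be the simple roots; the almost positive roots are the positive roots $e_i-e_j$ $(i<j)$ and the negative simple roots $-\alpha_k$. In a convex $(n+3)$-gon with vertices labelled $0,\dots,n+2$ in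 cyclic order, $-\alpha_1,\dots,-\alpha_n$ correspond to the successive diagonals $\{0,n+1\},\{1,n+1\},\{1,n\},\{2,n\},\dots$ of a snake (zigzag triangulation), and the positive root $\alpha_i+\dots+\alpha_j$ corresponds to the unique diagonal that, among the snake diagonals, crosses exactly those of $-\alpha_i,\dots,-\alpha_j$. Two almost positive roots are compatible if their diagonals do not cross, and a cluster is a maximal set of pairwise compatible almost positive roots. (2) $\mathrm{Ass}^{\mathrm I}_n(Q)$ is not affinely equivalent to the Minkowski sum $$\mathrm{Ass}^{\mathrm{III}}_n(\mathbf a)=\sum_{1\le i\le j\le n+1}a_{ij}\operatorname{conv}\{e_i,e_{i+1},\dots,e_j\}\subset\mathbb{R}^{n+1}$$ for any choice of positive real parameters $a_{ij}$, $1\le i\le j\le n+1$. Two polytopes $P\subset\mathbb{R}^d$ and $P'\subset\mathbb{R}^e$ are called affinely equivalent if some affine map $\mathbb{R}^d\to\mathbb{R}^e$ restricts to a bijection from $P$ onto $P'$. -/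

import Mathlib

open scoped Pointwise

noncomputable section

/-- Two polytopes, possibly in spaces of different dimension, are affinely equivalent if some affine
map between the ambient spaces restricts to a bijection between them. -/
def AffinelyEquivalent {E F : Type*} [AddCommGroup E] [Module ℝ E] [AddCommGroup F] [Module ℝ F]
    (P : Set E) (P' : Set F) : Prop :=
  ∃ f : E →ᵃ[ℝ] F, Set.BijOn f P P'

/-- A convex polytope: the convex hull of a nonempty finite set of points. -/
def IsPolytope {E : Type*} [AddCommGroup E] [Module ℝ E] (P : Set E) : Prop :=
  ∃ s : Finset E, s.Nonempty ∧ P = convexHull ℝ (s : Set E)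

/-! ### Secondary polytopes -/

/-- `t`, a finite set of `d`-dimensional simplices (given by the labels of their vertices), is a
triangulation, without new vertices, of the `d`-dimensional convex polytope with vertices `q i`:
the simplices cover the polytope and any two of them meet in a common (possibly empty) face. -/
structure IsTriangulation {d m : ℕ} (q : Fin m → Fin d → ℝ) (t : Finset (Finset (Fin m))) :
    Prop where
  card_eq : ∀ σ ∈ t, σ.card = d + 1
  affineIndependent : ∀ σ ∈ t, AffineIndependent ℝ (fun i : σ => q i)
  cover : ⋃ σ ∈ t, convexHull ℝ (q '' (σ : Set (Fin m))) = convexHull ℝ (Set.range q)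
  inter : ∀ σ ∈ t, ∀ τ ∈ t,
    convexHull ℝ (q '' (σ : Set (Fin m))) ∩ convexHull ℝ (q '' (τ : Set (Fin m))) =
      convexHull ℝ (q '' ((σ ∩ τ : Finset (Fin m)) : Set (Fin m)))

/-- The GKZ vector of `t`: its `i`-th coordinate is the total volume of the simplices of `t` that
have `q i` as a vertex. -/
def gkzVector {d m : ℕ} (q : Fin m → Fin d → ℝ) (t : Finset (Finset (Fin m))) : Fin m → ℝ :=
  fun i => ∑ σ ∈ t with i ∈ σ,
    (MeasureTheory.volume (convexHull ℝ (q '' (σ : Set (Fin m))))).toReal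

/-- The secondary polytope of the convex polytope with vertices `q i`. -/
def secondaryPolytope {d m : ℕ} (q : Fin m → Fin d → ℝ) : Set (Fin m → ℝ) :=
  convexHull ℝ {v | ∃ t, IsTriangulation q t ∧ v = gkzVector q t}

/-- The associahedron of type I of the convex `(n + 3)`-gon with vertices `q i`. -/
def assI (n : ℕ) (q : Fin (n + 3) → Fin 2 → ℝ) : Set (Fin (n + 3) → ℝ) :=
  secondaryPolytope q

/-! ### The cluster complex of type `A_n` -/

/-- The simple roots `α_k = e_k - e_{k+1}` of type `A_n` (indexed from `0`). -/
def simpleRoot (n : ℕ) (k : Fin n) : Fin (n + 1) → ℝ :=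
  Pi.single k.castSucc 1 - Pi.single k.succ 1

/-- The positive roots `e_i - e_j`, `i < j`, of type `A_n`. -/
def positiveRoots (n : ℕ) : Set (Fin (n + 1) → ℝ) :=
  {β | ∃ i j : Fin (n + 1), i < j ∧ β = Pi.single i 1 - Pi.single j 1}

/-- The almost positive roots: positive roots and negatives of simple roots. -/
def almostPositiveRoots (n : ℕ) : Set (Fin (n + 1) → ℝ) :=
  positiveRoots n ∪ {β | ∃ k : Fin n, β = -simpleRoot n k}

/-- `D` is (the pair of ends, in increasing order, of) a diagonal of a convex `(n + 3)`-gon whose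
vertices are labelled `0, …, n + 2` in cyclic order. -/
def IsDiagonal (n : ℕ) (D : ℕ × ℕ) : Prop :=
  D.1 + 1 < D.2 ∧ D.2 ≤ n + 2 ∧ ¬(D.1 = 0 ∧ D.2 = n + 2)

/-- Two diagonals cross if they meet in the interior of the polygon, i.e. if their ends
alternate. -/
def Cross (D D' : ℕ × ℕ) : Prop :=
  (D.1 < D'.1 ∧ D'.1 < D.2 ∧ D.2 < D'.2) ∨ (D'.1 < D.1 ∧ D.1 < D'.2 ∧ D'.2 < D.2)

/-- The `k`-th diagonal of the snake: the zigzag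
`{0, n + 1}, {1, n + 1}, {1, n}, {2, n}, {2, n - 1}, …` of `n` diagonals. -/
def snake (n : ℕ) (k : Fin n) : ℕ × ℕ :=
  ((k.val + 1) / 2, n + 1 - k.val / 2)

/-- The correspondence between almost positive roots and diagonals: `-α_k` corresponds to the
`k`-th diagonal of the snake, and `α_i + ⋯ + α_j` to the diagonal which, among the diagonals of the
snake, crosses exactly those of `-α_i, …, -α_j`. -/
def RootDiagonal (n : ℕ) (β : Fin (n + 1) → ℝ) (D : ℕ × ℕ) : Prop :=
  IsDiagonal n D ∧
    ((∃ k : Fin n, β = -simpleRoot n k ∧ D = snake n k) ∨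
      (∃ i j : Fin n, i ≤ j ∧ β = ∑ k ∈ Finset.Icc i j, simpleRoot n k ∧
        ∀ k : Fin n, Cross D (snake n k) ↔ k ∈ Finset.Icc i j))

/-- Two almost positive roots are compatible if their diagonals do not cross. -/
def Compatible (n : ℕ) (β γ : Fin (n + 1) → ℝ) : Prop :=
  ∃ D D' : ℕ × ℕ, RootDiagonal n β D ∧ RootDiagonal n γ D' ∧ ¬Cross D D'

/-- The simplices of the cluster complex: sets of pairwise compatible almost positive roots. -/
def IsClusterSimplex (n : ℕ) (C : Set (Fin (n + 1) → ℝ)) : Prop :=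
  C ⊆ almostPositiveRoots n ∧ ∀ β ∈ C, ∀ γ ∈ C, Compatible n β γ

/-- Clusters: maximal simplices of the cluster complex. -/
def IsCluster (n : ℕ) (C : Set (Fin (n + 1) → ℝ)) : Prop :=
  Maximal (IsClusterSimplex n) C

/-- The ambient space `x_1 + ⋯ + x_{n+1} = 0` of the cluster fan. -/
def rootSpace (n : ℕ) : Submodule ℝ (Fin (n + 1) → ℝ) where
  carrier := {x | ∑ i, x i = 0}
  add_mem' := by
    intro x y hx hy
    simp only [Set.mem_ofPred_eq, Pi.add_apply, Finset.sum_add_distrib] at *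
    rw [hx, hy, add_zero]
  zero_mem' := by simp
  smul_mem' := by
    intro c x hx
    simp only [Set.mem_ofPred_eq, Pi.smul_apply, smul_eq_mul, ← Finset.mul_sum] at *
    rw [hx, mul_zero]

/-- The (outer) normal cone, in the space `V`, of a face `F` of a polytope `P` contained in `V`:
the vectors `w` of `V` for which `x ↦ w ⬝ᵥ x` attains its maximum over `P` on all of `F`. -/
def normalCone {ι : Type*} [Fintype ι] (V : Submodule ℝ (ι → ℝ)) (P F : Set (ι → ℝ)) :
    Set (ι → ℝ) :=
  {w | w ∈ V ∧ ∀ x ∈ F, ∀ y ∈ P, w ⬝ᵥ y ≤ w ⬝ᵥ x}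

/-- The normal fan, in the space `V`, of a polytope `P` contained in `V`: the set of the normal
cones of its nonempty faces. -/
def normalFan {ι : Type*} [Fintype ι] (V : Submodule ℝ (ι → ℝ)) (P : Set (ι → ℝ)) :
    Set (Set (ι → ℝ)) :=
  {K | ∃ F : Set (ι → ℝ), F.Nonempty ∧ IsExposed ℝ P F ∧ K = normalCone V P F}

/-- `P` is an associahedron of type II: a polytope whose normal fan is the fan with maximal cones
`ℝ_{≥0} C`, for all clusters `C` of type `A_n`. -/
def IsAssII (n : ℕ) (P : Set (Fin (n + 1) → ℝ)) : Prop :=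
  IsPolytope P ∧ P ⊆ rootSpace n ∧
    {K | Maximal (· ∈ normalFan (rootSpace n) P) K} =
      {K | ∃ C, IsCluster n C ∧ K = (Submodule.span NNReal C : Set (Fin (n + 1) → ℝ))}

/-! ### Minkowski sums of simplices -/

/-- The associahedron of type III: the Minkowski sum of the simplices
`a i j • conv {e_i, …, e_j}` over all `i ≤ j`. -/
def assIII (n : ℕ) (a : Fin (n + 1) → Fin (n + 1) → ℝ) : Set (Fin (n + 1) → ℝ) :=
  ∑ i : Fin (n + 1), ∑ j ∈ Finset.Ici i,
    a i j • convexHull ℝ ((fun k : Fin (n + 1) => (Pi.single k 1 : Fin (n + 1) → ℝ)) '' Set.Icc i j)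

end

/-! The three families are told apart by an affine invariant: whether the polytope has a pair of
parallel facets. Types II and III always have one. Type I has none as soon as the polygon has at
least five vertices.

For type I, pairing the GKZ vector of `t` with the values `f (q i)` gives three times the integral
over the polygon of the interpolation of `f` that is affine on the triangles of `t`. If `f` is
concave, this is at most three times the integral of `f`, with equality when `f` is affine on each
triangle of `t`. The function `bend a b`, concave and broken along one line, therefore gives a
functional maximal at every triangulation that does not cross the diagonal `a b`. Modulo affine
functions, which pair to constants, each functional is a nonnegative combination of bends along
noncrossing chords (`IsCcw.exists_eq_sum_bend`). Hence a functional exposing a facet is, on the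
polytope, a positive multiple of a single bend up to a constant (`IsCcw.exists_eq_bendFunctional`).

Two parallel facets would thus give `α, β > 0` and diagonals `a b`, `c e` with `α * bend a b + β *
bend c e` constant on the polytope. Comparing triangulations that differ by a flip shows that a
functional constant there comes from an affine function (`IsCcw.relation_of_const`). So `α * |orient
a b ·| + β * |orient c e ·|` would be affine on the vertices. If the diagonals do not cross, some
quadrilateral is cut by one of them and not by the other. If they cross, a fifth vertex provides a
quadrilateral on which only one of the two terms fails to be affine. Both contradict affineness.

For type III, the coordinate `x 0` attains its maximum and its minimum on facets. For type II, each
cluster cone lies in an orthant for the simple root coordinates, because a positive root whose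
support contains `α_k` is incompatible with `-α_k`. This makes the faces in the directions `α_k` and
`-α_k` facets. -/

/-! ### Signed areas and integrals over triangles -/

/-- Twice the signed area of the triangle `a b c`. -/
def orient (a b c : Fin 2 → ℝ) : ℝ :=
  (b 0 - a 0) * (c 1 - a 1) - (b 1 - a 1) * (c 0 - a 0)

theorem orient_rotate (a b c : Fin 2 → ℝ) : orient b c a = orient a b c := by
  unfold orient; ring

theorem orient_swap (a b c : Fin 2 → ℝ) : orient a c b = -orient a b c := by
  unfold orient; ring

theorem orient_swap_left (a b c : Fin 2 → ℝ) : orient b a c = -orient a b c := by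
  unfold orient; ring

/-- The triangle with vertices `(0, 0)`, `(1, 0)`, `(0, 1)`. -/
def stdTriangle : Set (Fin 2 → ℝ) := {x | 0 ≤ x 0 ∧ 0 ≤ x 1 ∧ x 0 + x 1 ≤ 1}

/-- The linear part of the parametrization of the triangle `a b c`. -/
def triangleLinear (a b c : Fin 2 → ℝ) : (Fin 2 → ℝ) →ₗ[ℝ] (Fin 2 → ℝ) :=
  Matrix.toLin' !![b 0 - a 0, c 0 - a 0; b 1 - a 1, c 1 - a 1]

/-- The affine parametrization of the triangle `a b c` by the standard triangle. -/
def triangleMap (a b c : Fin 2 → ℝ) (x : Fin 2 → ℝ) : Fin 2 → ℝ := triangleLinear a b c x + a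

theorem det_triangleLinear (a b c : Fin 2 → ℝ) :
    LinearMap.det (triangleLinear a b c) = orient a b c := by
  rw [triangleLinear, LinearMap.det_toLin', Matrix.det_fin_two_of, orient]
  ring

theorem triangleMap_eq (a b c x : Fin 2 → ℝ) :
    triangleMap a b c x = (1 - x 0 - x 1) • a + x 0 • b + x 1 • c := by
  ext i
  fin_cases i <;> simp [triangleMap, triangleLinear, dotProduct] <;> ring

theorem convex_stdTriangle : Convex ℝ stdTriangle := by
  intro x hx y hy s t hs ht hst
  simp only [stdTriangle, Set.mem_ofPred_eq, Pi.add_apply, Pi.smul_apply, smul_eq_mul] at *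
  obtain ⟨hx0, hx1, hx2⟩ := hx
  obtain ⟨hy0, hy1, hy2⟩ := hy
  refine ⟨by positivity, by positivity, ?_⟩
  nlinarith

theorem isClosed_stdTriangle : IsClosed stdTriangle := by
  exact IsClosed.inter (isClosed_le (f := fun _ => (0 : ℝ)) (by fun_prop) (by fun_prop))
    (IsClosed.inter (isClosed_le (f := fun _ => (0 : ℝ)) (by fun_prop) (by fun_prop))
      (isClosed_le (f := fun x : Fin 2 → ℝ => x 0 + x 1) (g := fun _ => 1) (by fun_prop) (by fun_prop)))

theorem isCompact_stdTriangle : IsCompact stdTriangle := by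
  refine (isCompact_Icc (a := (0 : Fin 2 → ℝ)) (b := 1)).of_isClosed_subset
    isClosed_stdTriangle fun x hx => ?_
  obtain ⟨h0, h1, h2⟩ := hx
  refine ⟨fun i => ?_, fun i => ?_⟩ <;> fin_cases i <;> simp <;> linarith

theorem triangleMap_image (a b c : Fin 2 → ℝ) :
    triangleMap a b c '' stdTriangle = convexHull ℝ {a, b, c} := by
  apply Set.Subset.antisymm
  · rintro _ ⟨x, ⟨h0, h1, h2⟩, rfl⟩
    rw [triangleMap_eq]
    refine mem_convexHull_iff.2 fun t ht hconv => ?_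
    have ha : a ∈ t := ht (by simp)
    have hb : b ∈ t := ht (by simp)
    have hc : c ∈ t := ht (by simp)
    have := hconv.sum_mem (t := Finset.univ) (w := ![1 - x 0 - x 1, x 0, x 1])
      (z := ![a, b, c]) ?_ ?_ ?_
    · simpa [Fin.sum_univ_three] using this
    · intro i _; fin_cases i <;> simp <;> linarith
    · simp [Fin.sum_univ_three]; ring
    · intro i _; fin_cases i <;> simpa
  · have hconv : Convex ℝ (triangleMap a b c '' stdTriangle) := by
      have : triangleMap a b c '' stdTriangle =
          (fun x => x + a) '' (triangleLinear a b c '' stdTriangle) := by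
        rw [Set.image_image]; rfl
      rw [this]
      have h := (convex_stdTriangle.linear_image (triangleLinear a b c)).translate a
      simpa [add_comm] using h
    refine convexHull_min ?_ hconv
    rintro x (rfl | rfl | rfl)
    · exact ⟨0, by simp [stdTriangle], by simp [triangleMap_eq]⟩
    · exact ⟨![1, 0], by simp [stdTriangle], by simp [triangleMap_eq]⟩
    · exact ⟨![0, 1], by simp [stdTriangle], by simp [triangleMap_eq]⟩

theorem setIntegral_triangle {a b c : Fin 2 → ℝ} (h : orient a b c ≠ 0) (f : (Fin 2 → ℝ) → ℝ) :
    ∫ x in convexHull ℝ {a, b, c}, f x =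
      |orient a b c| * ∫ x in stdTriangle, f (triangleMap a b c x) := by
  have hder : ∀ x ∈ stdTriangle, HasFDerivWithinAt (triangleMap a b c)
      (LinearMap.toContinuousLinearMap (triangleLinear a b c)) stdTriangle x := by
    intro x _
    exact ((LinearMap.toContinuousLinearMap
      (triangleLinear a b c)).hasFDerivAt.add_const a).hasFDerivWithinAt
  have hinj : Set.InjOn (triangleMap a b c) stdTriangle := by
    intro x _ y _ hxy
    have hdet : LinearMap.det (triangleLinear a b c) ≠ 0 := by rwa [det_triangleLinear]
    exact ((triangleLinear a b c).equivOfDetNeZero hdet).injective (add_right_cancel hxy)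
  rw [← triangleMap_image,
    MeasureTheory.integral_image_eq_integral_abs_det_fderiv_smul MeasureTheory.volume
      isClosed_stdTriangle.measurableSet hder hinj]
  have : (LinearMap.toContinuousLinearMap (triangleLinear a b c)).det = orient a b c := by
    rw [← det_triangleLinear]; rfl
  simp only [this, smul_eq_mul]
  exact MeasureTheory.integral_const_mul _ _

theorem stdTriangle_eq : stdTriangle = convexHull ℝ {0, ![1, 0], ![0, 1]} := by
  rw [← triangleMap_image]
  have : triangleMap 0 ![1, 0] ![0, 1] = id := by
    funext x; rw [triangleMap_eq]; ext i; fin_cases i <;> simp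
  simp [this]

theorem volume_stdTriangle_pos : 0 < (MeasureTheory.volume stdTriangle).toReal := by
  refine ENNReal.toReal_pos ?_ isCompact_stdTriangle.measure_lt_top.ne
  refine (MeasureTheory.Measure.measure_pos_of_nonempty_interior _ ⟨fun _ => 1 / 4, ?_⟩).ne'
  have ho : IsOpen {x : Fin 2 → ℝ | 0 < x 0 ∧ 0 < x 1 ∧ x 0 + x 1 < 1} := by
    exact IsOpen.inter (isOpen_lt (f := fun _ => (0 : ℝ)) (by fun_prop) (by fun_prop))
      (IsOpen.inter (isOpen_lt (f := fun _ => (0 : ℝ)) (by fun_prop) (by fun_prop))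
        (isOpen_lt (f := fun x : Fin 2 → ℝ => x 0 + x 1) (g := fun _ => 1) (by fun_prop) (by fun_prop)))
  refine mem_interior.2 ⟨_, fun x hx => ?_, ho, by norm_num⟩
  exact ⟨hx.1.le, hx.2.1.le, hx.2.2.le⟩

theorem volume_triangle {a b c : Fin 2 → ℝ} (h : orient a b c ≠ 0) :
    (MeasureTheory.volume (convexHull ℝ {a, b, c})).toReal =
      |orient a b c| * (MeasureTheory.volume stdTriangle).toReal := by
  have := setIntegral_triangle h fun _ => 1
  simpa [MeasureTheory.measureReal_def] using this

/-- The affine map rotating the vertices of the standard triangle. -/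
abbrev stdRotation : (Fin 2 → ℝ) → Fin 2 → ℝ := triangleMap ![1, 0] ![0, 1] 0

/-- The rotation has determinant one and permutes the vertices of the standard triangle, so it
preserves both the triangle and the measure. -/
theorem setIntegral_stdRotation (f : (Fin 2 → ℝ) → ℝ) :
    ∫ x in stdTriangle, f (stdRotation x) = ∫ x in stdTriangle, f x := by
  have h1 : orient ![1, 0] ![0, 1] 0 = 1 := by simp [orient]
  have h := setIntegral_triangle (h1 ▸ one_ne_zero) f
  rw [h1, abs_one, one_mul] at h
  rw [← h, stdTriangle_eq]
  congr 3
  ext; simp; tauto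

theorem stdRotation_mem {x : Fin 2 → ℝ} (hx : x ∈ stdTriangle) : stdRotation x ∈ stdTriangle := by
  obtain ⟨h0, h1, h2⟩ := hx
  refine ⟨?_, ?_, ?_⟩ <;> simp [stdRotation, triangleMap_eq] <;> linarith

theorem continuous_triangleMap (a b c : Fin 2 → ℝ) : Continuous (triangleMap a b c) :=
  (LinearMap.continuous_of_finiteDimensional _).add continuous_const

theorem ConcaveOn.le_triangleMap {a b c : Fin 2 → ℝ} {f : (Fin 2 → ℝ) → ℝ}
    (hf : ConcaveOn ℝ (convexHull ℝ {a, b, c}) f) {x : Fin 2 → ℝ} (hx : x ∈ stdTriangle) :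
    (1 - x 0 - x 1) * f a + x 0 * f b + x 1 * f c ≤ f (triangleMap a b c x) := by
  obtain ⟨h0, h1, h2⟩ := hx
  have := hf.le_map_sum (t := Finset.univ) (w := ![1 - x 0 - x 1, x 0, x 1])
    (p := ![a, b, c]) ?_ ?_ ?_
  · rw [triangleMap_eq]
    simpa [Fin.sum_univ_three] using this
  · intro i _; fin_cases i <;> simp <;> linarith
  · simp [Fin.sum_univ_three]; ring
  · intro i _; fin_cases i <;> exact subset_convexHull _ _ (by simp)

/-- The mean value of a concave function on a triangle is at least its mean on the vertices. -/
theorem ConcaveOn.volume_mul_le_setIntegral {a b c : Fin 2 → ℝ} (h : orient a b c ≠ 0)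
    {f : (Fin 2 → ℝ) → ℝ} (hf : ConcaveOn ℝ (convexHull ℝ {a, b, c}) f) (hc : Continuous f) :
    (MeasureTheory.volume (convexHull ℝ {a, b, c})).toReal * (f a + f b + f c) ≤
      3 * ∫ x in convexHull ℝ {a, b, c}, f x := by
  rw [setIntegral_triangle h, volume_triangle h]
  set g : (Fin 2 → ℝ) → ℝ := fun x => f (triangleMap a b c x) with hg
  have hgc : Continuous g := hc.comp (continuous_triangleMap a b c)
  have hrc : Continuous stdRotation := continuous_triangleMap _ _ _
  have hint : ∀ k : (Fin 2 → ℝ) → ℝ, Continuous k →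
      MeasureTheory.IntegrableOn k stdTriangle := fun k hk =>
    hk.continuousOn.integrableOn_compact isCompact_stdTriangle
  have e1 := setIntegral_stdRotation g
  have e2 := setIntegral_stdRotation fun x => g (stdRotation x)
  -- At `x` and its two rotated images the barycentric coordinates are permuted cyclically. The
  -- three concavity bounds therefore add up to `f a + f b + f c`, whatever `x` is.
  have key : (MeasureTheory.volume stdTriangle).toReal * (f a + f b + f c) ≤
      ∫ x in stdTriangle, (g x + g (stdRotation x) + g (stdRotation (stdRotation x))) := by
    have : (MeasureTheory.volume stdTriangle).toReal * (f a + f b + f c) =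
        ∫ _ in stdTriangle, (f a + f b + f c) := by
      simp [MeasureTheory.measureReal_def]
    rw [this]
    refine MeasureTheory.setIntegral_mono_on (hint _ continuous_const) (hint _ (by fun_prop))
      isClosed_stdTriangle.measurableSet fun x hx => ?_
    have i1 := hf.le_triangleMap hx
    have i2 := hf.le_triangleMap (stdRotation_mem hx)
    have i3 := hf.le_triangleMap (stdRotation_mem (stdRotation_mem hx))
    simp only [stdRotation, triangleMap_eq ![1, 0], Pi.add_apply, Pi.smul_apply, smul_eq_mul,
      Matrix.cons_val_zero, Matrix.cons_val_one, Pi.zero_apply, hg] at i1 i2 i3 ⊢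
    refine le_trans (le_of_eq ?_) (add_le_add (add_le_add i1 i2) i3)
    ring
  have hs : ∫ x in stdTriangle, (g x + g (stdRotation x) + g (stdRotation (stdRotation x))) =
      3 * ∫ x in stdTriangle, g x := by
    rw [MeasureTheory.integral_add (hint (fun x => g x + g (stdRotation x)) (by fun_prop))
        (hint (fun x => g (stdRotation (stdRotation x))) (by fun_prop)),
      MeasureTheory.integral_add (hint g (by fun_prop))
        (hint (fun x => g (stdRotation x)) (by fun_prop)), e2, e1]
    ring
  rw [hs] at key
  have := mul_le_mul_of_nonneg_left key (abs_nonneg (orient a b c))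
  linarith

theorem collinear_of_orient_eq_zero {a b c : Fin 2 → ℝ} (h : orient a b c = 0) :
    Collinear ℝ {a, b, c} := by
  by_cases hba : b = a
  · rw [hba]; simpa using collinear_pair ℝ a c
  refine (collinear_iff_of_mem (p₀ := a) (by simp)).2 ⟨b - a, ?_⟩
  rintro p (rfl | rfl | rfl)
  · exact ⟨0, by simp⟩
  · exact ⟨1, by simp⟩
  unfold orient at h
  by_cases h0 : b 0 - a 0 = 0
  · have h1 : b 1 - a 1 ≠ 0 := by
      intro h1; apply hba; ext l; fin_cases l
      · exact sub_eq_zero.1 h0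
      · exact sub_eq_zero.1 h1
    refine ⟨(p 1 - a 1) / (b 1 - a 1), ?_⟩
    ext l; fin_cases l
    · have : (b 1 - a 1) * (p 0 - a 0) = 0 := by rw [h0] at h; linarith
      have := (mul_eq_zero.1 this).resolve_left h1
      simp [h0]; linarith
    · simp [div_mul_cancel₀ _ h1]
  · refine ⟨(p 0 - a 0) / (b 0 - a 0), ?_⟩
    ext l; fin_cases l
    · simp [div_mul_cancel₀ _ h0]
    · simp; field_simp; linarith

theorem orient_ne_zero_of_affineIndependent {ι : Type*} {q : ι → Fin 2 → ℝ} {σ : Finset ι}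
    (h : AffineIndependent ℝ fun i : σ => q i) {i j k : ι} (hi : i ∈ σ) (hj : j ∈ σ) (hk : k ∈ σ)
    (hij : i ≠ j) (hik : i ≠ k) (hjk : j ≠ k) : orient (q i) (q j) (q k) ≠ 0 := by
  intro h0
  have h' := h.comp_embedding ⟨![(⟨i, hi⟩ : σ), ⟨j, hj⟩, ⟨k, hk⟩], by
    intro x y; fin_cases x <;> fin_cases y <;> simp [hij, hik, hjk, hij.symm, hik.symm, hjk.symm]⟩
  have hcol := collinear_of_orient_eq_zero h0
  rw [collinear_iff_not_affineIndependent_set] at hcol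
  have he : ((fun i : σ => q i) ∘ ![(⟨i, hi⟩ : σ), ⟨j, hj⟩, ⟨k, hk⟩]) = ![q i, q j, q k] := by
    funext x; fin_cases x <;> rfl
  exact hcol (he ▸ h')

/-! ### Pairing GKZ vectors with concave functions -/

theorem isCompact_convexHull_image {ι : Type*} [Finite ι] (q : ι → Fin 2 → ℝ) (s : Set ι) :
    IsCompact (convexHull ℝ (q '' s)) :=
  (s.toFinite.image q).isCompact_convexHull (𝕜 := ℝ)

theorem volume_convexHull_image_eq_zero {ι : Type*} (q : ι → Fin 2 → ℝ) (s : Finset ι)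
    (hs : s.card ≤ 2) : MeasureTheory.volume (convexHull ℝ (q '' (s : Set ι))) = 0 := by
  classical
  rcases s.eq_empty_or_nonempty with rfl | hne
  · simp
  refine MeasureTheory.measure_mono_null (convexHull_subset_affineSpan _)
    (MeasureTheory.Measure.addHaar_affineSubspace _ _ fun htop => ?_)
  have h1 := finrank_vectorSpan_image_finset_le ℝ q s (n := s.card - 1)
    (by have := hne.card_pos; omega)
  have h2 : vectorSpan ℝ (q '' (s : Set ι)) = ⊤ := by
    rw [← direction_affineSpan, htop, AffineSubspace.direction_top]
  rw [Finset.coe_image, h2, finrank_top, Module.finrank_fin_fun] at h1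
  omega

namespace IsTriangulation

variable {m : ℕ} {q : Fin m → Fin 2 → ℝ} {t : Finset (Finset (Fin m))}

/-- Distinct triangles share at most two vertices, so their intersection lies in a line. -/
theorem aedisjoint (h : IsTriangulation q t) {σ τ : Finset (Fin m)} (hσ : σ ∈ t) (hτ : τ ∈ t)
    (hne : σ ≠ τ) : MeasureTheory.AEDisjoint MeasureTheory.volume
      (convexHull ℝ (q '' (σ : Set (Fin m)))) (convexHull ℝ (q '' (τ : Set (Fin m)))) := by
  rw [MeasureTheory.AEDisjoint, h.inter σ hσ τ hτ]
  apply volume_convexHull_image_eq_zero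
  by_contra hcard
  have h1 := h.card_eq σ hσ
  have h2 := h.card_eq τ hτ
  have e1 := Finset.eq_of_subset_of_card_le (Finset.inter_subset_left (s₁ := σ) (s₂ := τ))
    (by omega)
  have e2 := Finset.eq_of_subset_of_card_le (Finset.inter_subset_right (s₁ := σ) (s₂ := τ))
    (by omega)
  exact hne (e1.symm.trans e2)

theorem setIntegral_eq_sum (h : IsTriangulation q t) {f : (Fin 2 → ℝ) → ℝ} (hf : Continuous f) :
    ∫ x in convexHull ℝ (Set.range q), f x =
      ∑ σ ∈ t, ∫ x in convexHull ℝ (q '' (σ : Set (Fin m))), f x := by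
  have hcov : convexHull ℝ (Set.range q) =
      ⋃ σ : t, convexHull ℝ (q '' ((σ : Finset (Fin m)) : Set (Fin m))) := by
    rw [← h.cover, Set.iUnion_subtype]
  rw [hcov, MeasureTheory.integral_iUnion_ae, tsum_fintype,
    Finset.sum_coe_sort t fun σ => ∫ x in convexHull ℝ (q '' (σ : Set (Fin m))), f x]
  · exact fun σ => (isCompact_convexHull_image q _).measurableSet.nullMeasurableSet
  · intro σ τ hne
    exact h.aedisjoint σ.2 τ.2 fun e => hne (Subtype.ext e)
  · rw [← hcov, ← Set.image_univ]
    exact hf.continuousOn.integrableOn_compact (isCompact_convexHull_image q _)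

theorem sum_mul_gkzVector (f : Fin m → ℝ) :
    ∑ i, f i * gkzVector q t i =
      ∑ σ ∈ t, (MeasureTheory.volume (convexHull ℝ (q '' (σ : Set (Fin m))))).toReal *
        ∑ i ∈ σ, f i := by
  simp only [gkzVector, Finset.mul_sum, Finset.sum_filter]
  rw [Finset.sum_comm]
  refine Finset.sum_congr rfl fun σ _ => ?_
  simp only [mul_ite, mul_zero, Finset.sum_ite_mem, Finset.univ_inter]
  exact Finset.sum_congr rfl fun i _ => mul_comm _ _

theorem volume_mul_sum_le (h : IsTriangulation q t) {f : (Fin 2 → ℝ) → ℝ} (hc : Continuous f)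
    {σ : Finset (Fin m)} (hσ : σ ∈ t)
    (hf : ConcaveOn ℝ (convexHull ℝ (q '' (σ : Set (Fin m)))) f) :
    (MeasureTheory.volume (convexHull ℝ (q '' (σ : Set (Fin m))))).toReal * ∑ i ∈ σ, f (q i) ≤
      3 * ∫ x in convexHull ℝ (q '' (σ : Set (Fin m))), f x := by
  classical
  obtain ⟨i, j, k, hij, hik, hjk, rfl⟩ := Finset.card_eq_three.1 (h.card_eq σ hσ)
  have hor := orient_ne_zero_of_affineIndependent (h.affineIndependent _ hσ) (i := i) (j := j)
    (k := k) (by simp) (by simp) (by simp) hij hik hjk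
  have him : q '' (({i, j, k} : Finset (Fin m)) : Set (Fin m)) = {q i, q j, q k} := by
    simp [Set.image_insert_eq]
  rw [him] at hf ⊢
  have := hf.volume_mul_le_setIntegral hor hc
  rwa [Finset.sum_insert (by simp [hij, hik]), Finset.sum_insert (by simp [hjk]),
    Finset.sum_singleton, ← add_assoc]

theorem sum_mul_gkzVector_le (h : IsTriangulation q t) {f : (Fin 2 → ℝ) → ℝ} (hc : Continuous f)
    (hf : ConcaveOn ℝ Set.univ f) :
    ∑ i, f (q i) * gkzVector q t i ≤ 3 * ∫ x in convexHull ℝ (Set.range q), f x := by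
  rw [sum_mul_gkzVector fun i => f (q i), h.setIntegral_eq_sum hc, Finset.mul_sum]
  exact Finset.sum_le_sum fun σ hσ => h.volume_mul_sum_le hc hσ
    (hf.subset (Set.subset_univ _) (convex_convexHull _ _))

/-- If `f` is affine on each triangle of `t`, pairing with the GKZ vector computes its integral. -/
theorem sum_mul_gkzVector_eq (h : IsTriangulation q t) {f : (Fin 2 → ℝ) → ℝ} (hc : Continuous f)
    (hf : ∀ σ ∈ t, ConcaveOn ℝ (convexHull ℝ (q '' (σ : Set (Fin m)))) f)
    (hf' : ∀ σ ∈ t, ConvexOn ℝ (convexHull ℝ (q '' (σ : Set (Fin m)))) f) :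
    ∑ i, f (q i) * gkzVector q t i = 3 * ∫ x in convexHull ℝ (Set.range q), f x := by
  rw [sum_mul_gkzVector fun i => f (q i), h.setIntegral_eq_sum hc, Finset.mul_sum]
  refine Finset.sum_congr rfl fun σ hσ => le_antisymm (h.volume_mul_sum_le hc hσ (hf σ hσ)) ?_
  have := h.volume_mul_sum_le hc.neg hσ (hf' σ hσ).neg
  simp only [Pi.neg_apply, Finset.sum_neg_distrib, mul_neg, MeasureTheory.integral_neg] at this
  linarith

end IsTriangulation

/-- A point of the secondary polytope pairs with concave functions at most as their integral. -/
theorem secondaryPolytope_sum_le {m : ℕ} {q : Fin m → Fin 2 → ℝ} {f : (Fin 2 → ℝ) → ℝ}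
    (hc : Continuous f) (hf : ConcaveOn ℝ Set.univ f) {v : Fin m → ℝ}
    (hv : v ∈ secondaryPolytope q) :
    ∑ i, f (q i) * v i ≤ 3 * ∫ x in convexHull ℝ (Set.range q), f x := by
  have hconv : Convex ℝ {v : Fin m → ℝ |
      ∑ i, f (q i) * v i ≤ 3 * ∫ x in convexHull ℝ (Set.range q), f x} := by
    refine convex_halfSpace_le (f := fun v : Fin m → ℝ => ∑ i, f (q i) * v i) ⟨?_, ?_⟩ _
    · intro x y; simp [mul_add, Finset.sum_add_distrib]
    · intro c x; simp only [Pi.smul_apply, smul_eq_mul, Finset.mul_sum]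
      exact Finset.sum_congr rfl fun i _ => by ring
  refine convexHull_min ?_ hconv hv
  rintro _ ⟨t, ht, rfl⟩
  exact ht.sum_mul_gkzVector_le hc hf

/-- The inequality for `f` and for `-f`. For affine `f` these are linear equations satisfied on the
whole polytope. -/
theorem secondaryPolytope_sum_eq {m : ℕ} {q : Fin m → Fin 2 → ℝ} {f : (Fin 2 → ℝ) → ℝ}
    (hc : Continuous f) (hf : ConcaveOn ℝ Set.univ f) (hf' : ConvexOn ℝ Set.univ f)
    {v : Fin m → ℝ} (hv : v ∈ secondaryPolytope q) :
    ∑ i, f (q i) * v i = 3 * ∫ x in convexHull ℝ (Set.range q), f x := by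
  refine le_antisymm (secondaryPolytope_sum_le hc hf hv) ?_
  have := secondaryPolytope_sum_le hc.neg hf'.neg hv
  simp only [Pi.neg_apply, neg_mul, Finset.sum_neg_distrib, mul_neg,
    MeasureTheory.integral_neg] at this
  linarith

/-! ### Relabelling the vertices -/

theorem IsTriangulation.map {d m : ℕ} {q : Fin m → Fin d → ℝ} (e : Equiv.Perm (Fin m))
    {t : Finset (Finset (Fin m))} (h : IsTriangulation (q ∘ e) t) :
    IsTriangulation q (t.image fun σ => σ.image e) := by
  have him : ∀ σ : Finset (Fin m), q '' ((σ.image e : Finset (Fin m)) : Set (Fin m)) =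
      (q ∘ e) '' (σ : Set (Fin m)) := fun σ => by
    rw [Finset.coe_image, Set.image_comp]
  constructor
  · simp only [Finset.mem_image, forall_exists_index, and_imp]
    rintro _ σ hσ rfl
    rw [Finset.card_image_of_injective _ e.injective, h.card_eq σ hσ]
  · simp only [Finset.mem_image, forall_exists_index, and_imp]
    rintro _ σ hσ rfl
    have h1 := h.affineIndependent σ hσ
    have h2 := h1.comp_embedding
      ⟨fun i : (σ.image e : Finset (Fin m)) => (⟨e.symm i, by
        obtain ⟨i, hi⟩ := i
        obtain ⟨j, hj, rfl⟩ := Finset.mem_image.1 hi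
        simpa using hj⟩ : σ), fun x y hxy => by
          exact Subtype.ext (e.symm.injective (Subtype.ext_iff.1 hxy))⟩
    convert h2 using 1
    funext i
    change q i = q (e (e.symm i))
    rw [e.apply_symm_apply]
  · rw [Finset.set_biUnion_finset_image]
    simp only [him]
    rw [h.cover, Set.range_comp, e.surjective.range_eq, Set.image_univ]
  · simp only [Finset.mem_image, forall_exists_index, and_imp]
    rintro _ σ hσ rfl _ τ hτ rfl
    rw [← Finset.image_inter _ _ e.injective, him, him, him, h.inter σ hσ τ hτ]

theorem gkzVector_map {d m : ℕ} (q : Fin m → Fin d → ℝ) (e : Equiv.Perm (Fin m))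
    (t : Finset (Finset (Fin m))) :
    gkzVector q (t.image fun σ => σ.image e) ∘ e = gkzVector (q ∘ e) t := by
  funext i
  simp only [gkzVector, Function.comp_apply]
  have hinj : Function.Injective fun σ : Finset (Fin m) => σ.image e :=
    Finset.image_injective e.injective
  rw [Finset.filter_image, Finset.sum_image hinj.injOn]
  refine Finset.sum_congr ?_ fun σ _ => ?_
  · ext σ; simp
  · rw [Finset.coe_image, ← Set.image_comp]
    rfl

/-- Relabelling vertices only permutes coordinates. This allows the cyclic order to be assumed
counterclockwise, although the given labelling is arbitrary. -/
theorem secondaryPolytope_comp_subset {d m : ℕ} (q : Fin m → Fin d → ℝ)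
    (e : Equiv.Perm (Fin m)) :
    secondaryPolytope (q ∘ e) ⊆ LinearMap.funLeft ℝ ℝ e '' secondaryPolytope q := by
  rw [secondaryPolytope, secondaryPolytope, LinearMap.image_convexHull]
  apply convexHull_mono
  rintro _ ⟨t, ht, rfl⟩
  exact ⟨_, ⟨_, ht.map e, rfl⟩, gkzVector_map q e t⟩

theorem bijOn_secondaryPolytope_comp {d m : ℕ} (q : Fin m → Fin d → ℝ) (e : Equiv.Perm (Fin m)) :
    Set.BijOn (LinearMap.funLeft ℝ ℝ e.symm) (secondaryPolytope (q ∘ e)) (secondaryPolytope q) := by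
  refine ⟨?_, (LinearMap.funLeft_injective_of_surjective ℝ ℝ _ e.symm.surjective).injOn, ?_⟩
  · intro v hv
    obtain ⟨w, hw, rfl⟩ := secondaryPolytope_comp_subset q e hv
    convert hw
    ext i; simp [LinearMap.funLeft]
  · have := secondaryPolytope_comp_subset (q ∘ e) e.symm
    have hq : (q ∘ e) ∘ e.symm = q := by ext; simp
    rw [hq] at this
    exact this

theorem AffinelyEquivalent.of_comp {d m : ℕ} {q : Fin m → Fin d → ℝ} (e : Equiv.Perm (Fin m))
    {F : Type*} [AddCommGroup F] [Module ℝ F] {P : Set F}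
    (h : AffinelyEquivalent (secondaryPolytope q) P) :
    AffinelyEquivalent (secondaryPolytope (q ∘ e)) P := by
  obtain ⟨f, hf⟩ := h
  exact ⟨f.comp (LinearMap.funLeft ℝ ℝ e.symm).toAffineMap,
    hf.comp (bijOn_secondaryPolytope_comp q e)⟩

/-! ### Cyclic order of the vertices of a convex polygon -/

/-- The points `p i` are the vertices, in counterclockwise order, of a convex polygon. -/
def IsCcw {m : ℕ} (p : Fin m → Fin 2 → ℝ) : Prop :=
  ∀ i j k, i < j → j < k → 0 < orient (p i) (p j) (p k)

theorem mem_convexHull_of_orient {a b c x : Fin 2 → ℝ} (h : 0 < orient a b c)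
    (h1 : 0 ≤ orient a b x) (h2 : 0 ≤ orient b c x) (h3 : 0 ≤ orient c a x) :
    x ∈ convexHull ℝ {a, b, c} := by
  rw [← triangleMap_image]
  have hs : orient a b x + orient b c x + orient c a x = orient a b c := by unfold orient; ring
  -- The barycentric coordinates of `x` are ratios of areas.
  refine ⟨![orient c a x / orient a b c, orient a b x / orient a b c], ⟨?_, ?_, ?_⟩, ?_⟩
  · simp; positivity
  · simp; positivity
  · simp; rw [← add_div, div_le_one h]; linarith
  · rw [triangleMap_eq]
    ext l
    simp only [Matrix.cons_val_zero, Matrix.cons_val_one, Pi.add_apply, Pi.smul_apply,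
      smul_eq_mul]
    field_simp
    unfold orient
    fin_cases l <;> simp <;> ring

section Order

variable {m : ℕ} {q : Fin m → Fin 2 → ℝ}

theorem ConvexIndependent.notMem_triangle (hq : ConvexIndependent ℝ q) {x i j k : Fin m}
    (hi : x ≠ i) (hj : x ≠ j) (hk : x ≠ k) : q x ∉ convexHull ℝ {q i, q j, q k} := by
  intro h
  have : ({q i, q j, q k} : Set (Fin 2 → ℝ)) = q '' {i, j, k} := by simp [Set.image_insert_eq]
  rw [this] at h
  have := hq {i, j, k} x h
  simp [hi, hj, hk] at this

theorem mem_segment_of_orient_eq_zero {a b c : Fin 2 → ℝ} (h : orient a b c = 0) :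
    a ∈ segment ℝ b c ∨ b ∈ segment ℝ a c ∨ c ∈ segment ℝ a b := by
  have hcol := collinear_of_orient_eq_zero h
  rcases hcol.wbtw_or_wbtw_or_wbtw with h | h | h
  · exact Or.inr (Or.inl (mem_segment_iff_wbtw.2 h))
  · exact Or.inr (Or.inr (mem_segment_iff_wbtw.2 h.symm))
  · exact Or.inl (mem_segment_iff_wbtw.2 h.symm)

theorem ConvexIndependent.orient_ne_zero (hq : ConvexIndependent ℝ q) {i j k : Fin m}
    (hij : i ≠ j) (hik : i ≠ k) (hjk : j ≠ k) : orient (q i) (q j) (q k) ≠ 0 := by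
  intro h
  have hsub : ∀ a b : Fin 2 → ℝ, segment ℝ a b ⊆ convexHull ℝ {a, b, b} := fun a b => by
    rw [Set.pair_eq_singleton, convexHull_pair]
  rcases mem_segment_of_orient_eq_zero h with h | h | h
  · exact hq.notMem_triangle hij hik hik (hsub _ _ h)
  · exact hq.notMem_triangle hij.symm hjk hjk (hsub _ _ h)
  · exact hq.notMem_triangle hik.symm hjk.symm hjk.symm (hsub _ _ h)

/-- Otherwise `q o` would lie in the triangle `q i`, `q j`, `q k`. Thus the angular order around a
vertex is transitive. -/
theorem ConvexIndependent.orient_trans (hq : ConvexIndependent ℝ q) {o i j k : Fin m}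
    (h1 : 0 < orient (q o) (q i) (q j)) (h2 : 0 < orient (q o) (q j) (q k)) :
    0 < orient (q o) (q i) (q k) := by
  have ho : ∀ a b, orient a a b = 0 ∧ orient a b a = 0 ∧ orient b a a = 0 := fun a b => by
    unfold orient; refine ⟨?_, ?_, ?_⟩ <;> ring
  have hoi : o ≠ i := by rintro rfl; simp [(ho _ _).1] at h1
  have hoj : o ≠ j := by rintro rfl; simp [(ho _ _).1] at h2
  have hok : o ≠ k := by rintro rfl; simp [(ho _ _).2.1] at h2
  have hik : i ≠ k := by
    rintro rfl; rw [orient_swap] at h2; linarith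
  by_contra! h3
  have h3' := lt_of_le_of_ne h3 (hq.orient_ne_zero hoi hok hik)
  refine hq.notMem_triangle hoi hoj hok (mem_convexHull_of_orient (a := q i) (b := q j)
    (c := q k) ?_ ?_ ?_ ?_)
  · have : orient (q i) (q j) (q k) = orient (q o) (q i) (q j) + orient (q o) (q j) (q k) -
      orient (q o) (q i) (q k) := by unfold orient; ring
    linarith
  · rw [orient_rotate]; exact h1.le
  · rw [orient_rotate]; exact h2.le
  · rw [orient_rotate, orient_swap]; linarith

/-- Otherwise the middle point `q j` would lie in the triangle `q o`, `q i`, `q k`. -/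
theorem ConvexIndependent.orient_pos_of_fan (hq : ConvexIndependent ℝ q) {o i j k : Fin m}
    (h1 : 0 < orient (q o) (q i) (q j)) (h2 : 0 < orient (q o) (q j) (q k)) :
    0 < orient (q i) (q j) (q k) := by
  have h3 := hq.orient_trans h1 h2
  have ho : ∀ a b, orient a a b = 0 ∧ orient a b a = 0 ∧ orient b a a = 0 := fun a b => by
    unfold orient; refine ⟨?_, ?_, ?_⟩ <;> ring
  have hoj : j ≠ o := by rintro rfl; simp [(ho _ _).1] at h2
  have hij : i ≠ j := by rintro rfl; simp [(ho _ _).2.2] at h1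
  have hjk : j ≠ k := by rintro rfl; simp [(ho _ _).2.2] at h2
  have hik : i ≠ k := by rintro rfl; simp [(ho _ _).2.2] at h3
  by_contra! h4
  have h4' := lt_of_le_of_ne h4 (hq.orient_ne_zero hij hik hjk)
  refine hq.notMem_triangle hoj hij.symm hjk (mem_convexHull_of_orient h3 h1.le ?_ ?_)
  · rw [orient_swap]; linarith
  · rw [← orient_rotate]; exact h2.le

/-- The vertices are sorted by angle as seen from `q 0`, which is itself placed first. -/
theorem ConvexIndependent.exists_isCcw (hq : ConvexIndependent ℝ q) :
    ∃ e : Equiv.Perm (Fin m), IsCcw (q ∘ e) := by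
  classical
  rcases m with _ | m
  · exact ⟨Equiv.refl _, fun i => i.elim0⟩
  let r : Fin (m + 1) → Fin (m + 1) → Prop := fun i j =>
    j ≠ 0 ∧ (i = 0 ∨ 0 < orient (q 0) (q i) (q j))
  have ho : ∀ a b, orient a a b = 0 ∧ orient a b a = 0 ∧ orient b a a = 0 := fun a b => by
    unfold orient; refine ⟨?_, ?_, ?_⟩ <;> ring
  have hsto : IsStrictTotalOrder (Fin (m + 1)) r :=
    { trichotomous := by
        intro i j hij hji
        by_contra hne
        by_cases hi : i = 0
        · exact hij ⟨fun hj => hne (hi.trans hj.symm), Or.inl hi⟩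
        by_cases hj : j = 0
        · exact hji ⟨hi, Or.inl hj⟩
        have h0 := hq.orient_ne_zero (Ne.symm hi) (Ne.symm hj) hne
        rcases lt_or_gt_of_ne h0 with h | h
        · exact hji ⟨hi, Or.inr (by rw [orient_swap]; linarith)⟩
        · exact hij ⟨hj, Or.inr h⟩
      irrefl := by
        rintro i ⟨hi, h | h⟩
        · exact hi h
        · simp [(ho _ _).2.2] at h
      trans := by
        rintro i j k ⟨hj, hij⟩ ⟨hk, hjk⟩
        refine ⟨hk, ?_⟩
        rcases hij with h | h
        · exact Or.inl h
        · exact Or.inr (hq.orient_trans h (hjk.resolve_left hj)) }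
  let L : LinearOrder (Fin (m + 1)) := @linearOrderOfSTO _ r hsto (Classical.decRel _)
  obtain ⟨e, he⟩ : ∃ e : Equiv.Perm (Fin (m + 1)), ∀ i j, i < j → r (e i) (e j) := by
    have hc := Fintype.card_fin (m + 1)
    let e' := @Fintype.orderIsoFinOfCardEq (Fin (m + 1)) L _ (m + 1) hc
    refine ⟨e'.toEquiv, fun i j hij => ?_⟩
    exact (@OrderIso.lt_iff_lt (Fin (m + 1)) (Fin (m + 1)) _ L.toPreorder e' i j).2 hij
  refine ⟨e, fun i j k hij hjk => ?_⟩
  obtain ⟨hj, h1⟩ := he i j hij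
  obtain ⟨hk, h2⟩ := he j k hjk
  have h2 := h2.resolve_left hj
  rcases h1 with h1 | h1
  · simp only [Function.comp_apply, h1]; exact h2
  · exact hq.orient_pos_of_fan h1 h2

end Order

/-! ### Triangulations built recursively from intervals of vertices -/

theorem mem_convexHull_face {E : Type*} [AddCommGroup E] [Module ℝ E] {S : Set E}
    (f : E →ᵃ[ℝ] ℝ) {c : ℝ} (hf : ∀ y ∈ S, f y ≤ c) {x : E} (hx : x ∈ convexHull ℝ S)
    (hxc : f x = c) : x ∈ convexHull ℝ {y ∈ S | f y = c} := by
  have hconv : Convex ℝ {x | f x ≤ c ∧ (f x = c → x ∈ convexHull ℝ {y ∈ S | f y = c})} := by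
    rw [convex_iff_forall_pos]
    intro x hx y hy s t hs ht hst
    have he : f (s • x + t • y) = s * f x + t * f y := Convex.combo_affine_apply hst
    refine ⟨?_, fun h => ?_⟩
    · rw [he]
      calc s * f x + t * f y ≤ s * c + t * c :=
            add_le_add (mul_le_mul_of_nonneg_left hx.1 hs.le) (mul_le_mul_of_nonneg_left hy.1 ht.le)
        _ = c := by rw [← add_mul, hst, one_mul]
    · have hc : s * c + t * c = c := by rw [← add_mul, hst, one_mul]
      have h1 : s * f x ≤ s * c := mul_le_mul_of_nonneg_left hx.1 hs.le
      have h2 : t * f y ≤ t * c := mul_le_mul_of_nonneg_left hy.1 ht.le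
      have h3 : s * f x = s * c := by linarith
      have h4 : t * f y = t * c := by linarith
      exact convex_convexHull ℝ _ (hx.2 (mul_left_cancel₀ hs.ne' h3))
        (hy.2 (mul_left_cancel₀ ht.ne' h4)) hs.le ht.le hst
  have hS : S ⊆ {x | f x ≤ c ∧ (f x = c → x ∈ convexHull ℝ {y ∈ S | f y = c})} :=
    fun y hy => ⟨hf y hy, fun h => subset_convexHull ℝ _ ⟨hy, h⟩⟩
  exact (convexHull_min hS hconv hx).2 hxc

/-- `orient a b` as an affine function of the third vertex. -/
def orientAffine (a b : Fin 2 → ℝ) : (Fin 2 → ℝ) →ᵃ[ℝ] ℝ :=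
  ((b 0 - a 0) • (LinearMap.proj 1 : (Fin 2 → ℝ) →ₗ[ℝ] ℝ) -
    (b 1 - a 1) • (LinearMap.proj 0 : (Fin 2 → ℝ) →ₗ[ℝ] ℝ)).toAffineMap +
      AffineMap.const ℝ _ ((b 1 - a 1) * a 0 - (b 0 - a 0) * a 1)

@[simp]
theorem orientAffine_apply (a b x : Fin 2 → ℝ) : orientAffine a b x = orient a b x := by
  simp [orientAffine, orient]; ring

theorem orient_self_left (a b : Fin 2 → ℝ) : orient a a b = 0 := by unfold orient; ring

theorem orient_self_right (a b : Fin 2 → ℝ) : orient a b b = 0 := by unfold orient; ring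

theorem orient_self_outer (a b : Fin 2 → ℝ) : orient a b a = 0 := by unfold orient; ring

theorem orient_eq_zero_of_collinear {a b c : Fin 2 → ℝ} (h : Collinear ℝ {a, b, c}) :
    orient a b c = 0 := by
  obtain ⟨v, hv⟩ := (collinear_iff_of_mem (p₀ := a) (by simp)).1 h
  obtain ⟨s, hs⟩ := hv b (by simp)
  obtain ⟨t, ht⟩ := hv c (by simp)
  rw [hs, ht, orient]
  simp
  ring

theorem affineIndependent_of_orient_ne_zero {ι : Type*} [DecidableEq ι] {q : ι → Fin 2 → ℝ}
    {i j k : ι} (h : orient (q i) (q j) (q k) ≠ 0) :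
    AffineIndependent ℝ fun x : ({i, j, k} : Finset ι) => q x := by
  have h1 : AffineIndependent ℝ ![q i, q j, q k] := by
    rw [affineIndependent_iff_not_collinear_set]
    exact fun hc => h (orient_eq_zero_of_collinear hc)
  have hmem : ∀ x : ({i, j, k} : Finset ι), (x : ι) = i ∨ (x : ι) = j ∨ (x : ι) = k := by
    rintro ⟨x, hx⟩
    simpa using hx
  let g : ({i, j, k} : Finset ι) → Fin 3 := fun x =>
    if (x : ι) = i then 0 else if (x : ι) = j then 1 else 2
  have hg : ∀ x, ![i, j, k] (g x) = x := by
    intro x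
    simp only [g]
    rcases hmem x with hx | hx | hx <;> split_ifs <;> simp_all
  have hginj : Function.Injective g := fun x y hxy => Subtype.ext (by rw [← hg x, ← hg y, hxy])
  convert h1.comp_embedding ⟨g, hginj⟩ using 1
  funext x
  have : ∀ l, ![q i, q j, q k] l = q (![i, j, k] l) := by intro l; fin_cases l <;> rfl
  simp [this, hg]

/-- `t` is a triangulation, in terms of labels, of the convex polygon with vertices `i, …, j`. -/
inductive IntervalTriangulation {m : ℕ} : Fin m → Fin m → Finset (Finset (Fin m)) → Prop
  | edge {i j : Fin m} (h : i ⋖ j) : IntervalTriangulation i j ∅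
  | node {i k j : Fin m} {t₁ t₂ : Finset (Finset (Fin m))} (hik : i < k) (hkj : k < j)
      (h₁ : IntervalTriangulation i k t₁) (h₂ : IntervalTriangulation k j t₂) :
      IntervalTriangulation i j (insert {i, k, j} (t₁ ∪ t₂))

/-- No triangle of `t` crosses the segment between the vertices `a` and `b`. -/
def NotCrossing {m : ℕ} (t : Finset (Finset (Fin m))) (a b : Fin m) : Prop :=
  ∀ σ ∈ t, (∀ x ∈ σ, a ≤ x ∧ x ≤ b) ∨ (∀ x ∈ σ, x ≤ a ∨ b ≤ x)

namespace IsCcw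

variable {m : ℕ} {p : Fin m → Fin 2 → ℝ}

theorem orient_neg (hp : IsCcw p) {a b x : Fin m} (h1 : a < x) (h2 : x < b) :
    orient (p a) (p b) (p x) < 0 := by
  rw [orient_swap]; linarith [hp a x b h1 h2]

theorem orient_nonpos (hp : IsCcw p) {a b x : Fin m} (h1 : a ≤ x) (h2 : x ≤ b) :
    orient (p a) (p b) (p x) ≤ 0 := by
  rcases h1.eq_or_lt with rfl | h1
  · rw [orient_self_outer]
  rcases h2.eq_or_lt with rfl | h2
  · rw [orient_self_right]
  exact (hp.orient_neg h1 h2).le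

theorem orient_pos (hp : IsCcw p) {a b x : Fin m} (hab : a < b) (h : x < a ∨ b < x) :
    0 < orient (p a) (p b) (p x) := by
  rcases h with h | h
  · rw [orient_rotate]; exact hp x a b h hab
  · exact hp a b x hab h

theorem orient_nonneg (hp : IsCcw p) {a b x : Fin m} (hab : a < b) (h : x ≤ a ∨ b ≤ x) :
    0 ≤ orient (p a) (p b) (p x) := by
  rcases h with h | h
  · rcases h.eq_or_lt with rfl | h
    · rw [orient_self_outer]
    · exact (hp.orient_pos hab (Or.inl h)).le
  · rcases h.eq_or_lt with rfl | h
    · rw [orient_self_right]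
    · exact (hp.orient_pos hab (Or.inr h)).le

theorem injective (hp : IsCcw p) (hm : 3 ≤ m) : Function.Injective p := by
  intro a b hab
  by_contra hne
  wlog hlt : a < b generalizing a b
  · exact this hab.symm (Ne.symm hne) (lt_of_le_of_ne (not_lt.1 hlt) (Ne.symm hne))
  obtain ⟨x, hxa, hxb⟩ : ∃ x : Fin m, x ≠ a ∧ x ≠ b := by
    have : ∃ x ∈ (Finset.univ : Finset (Fin m)), x ∉ ({a, b} : Finset (Fin m)) :=
      Finset.exists_mem_notMem_of_card_lt_card (by
        refine lt_of_le_of_lt (Finset.card_le_two) ?_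
        rw [Finset.card_univ, Fintype.card_fin]; omega)
    obtain ⟨x, _, hx⟩ := this
    exact ⟨x, by simpa using hx⟩
  have h0 : orient (p a) (p b) (p x) = 0 := by rw [hab, orient_self_left]
  rcases lt_or_gt_of_ne hxa with h | h
  · exact (hp.orient_pos hlt (Or.inl h)).ne' h0
  rcases lt_or_gt_of_ne hxb with h' | h'
  · exact (hp.orient_neg h h').ne h0
  · exact (hp.orient_pos hlt (Or.inr h')).ne' h0

/-- The chord `a b` separates the two hulls, so a common point is on its line and lies in the faces
of both hulls there. The only vertices on that line are `a` and `b`, which reduces the claim to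
subsets of an affinely independent pair. -/
theorem inter_eq (hp : IsCcw p) (hm : 3 ≤ m) {a b : Fin m} (hab : a < b) {σ τ : Finset (Fin m)}
    (hσ : ∀ x ∈ σ, a ≤ x ∧ x ≤ b) (hτ : ∀ x ∈ τ, x ≤ a ∨ b ≤ x) :
    convexHull ℝ (p '' (σ : Set (Fin m))) ∩ convexHull ℝ (p '' (τ : Set (Fin m))) =
      convexHull ℝ (p '' ((σ ∩ τ : Finset (Fin m)) : Set (Fin m))) := by
  apply Set.Subset.antisymm
  · rintro x ⟨hx1, hx2⟩
    have hσ' : ∀ y ∈ p '' (σ : Set (Fin m)), orientAffine (p a) (p b) y ≤ 0 := by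
      rintro _ ⟨y, hy, rfl⟩
      simpa using hp.orient_nonpos (hσ y hy).1 (hσ y hy).2
    have hτ' : ∀ y ∈ p '' (τ : Set (Fin m)), (-orientAffine (p a) (p b)) y ≤ 0 := by
      rintro _ ⟨y, hy, rfl⟩
      simpa using hp.orient_nonneg hab (hτ y hy)
    have c1 : orientAffine (p a) (p b) x ≤ 0 :=
      convexHull_min (t := {y | orientAffine (p a) (p b) y ≤ 0}) hσ'
        ((convex_Iic (0 : ℝ)).affine_preimage (orientAffine (p a) (p b))) hx1
    have c2 : (-orientAffine (p a) (p b)) x ≤ 0 :=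
      convexHull_min (t := {y | (-orientAffine (p a) (p b)) y ≤ 0}) hτ'
        ((convex_Iic (0 : ℝ)).affine_preimage (-orientAffine (p a) (p b))) hx2
    have c3 : orientAffine (p a) (p b) x = 0 := by
      simp only [AffineMap.coe_neg, Pi.neg_apply] at c2; linarith
    have f1 := mem_convexHull_face _ hσ' hx1 c3
    have f2 := mem_convexHull_face _ hτ' hx2 (by simp [c3] : (-orientAffine (p a) (p b)) x = 0)
    have hends : ∀ y, orient (p a) (p b) (p y) = 0 → y = a ∨ y = b := by
      intro y hy
      by_contra! hne
      rcases lt_or_gt_of_ne hne.1 with h | h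
      · exact (hp.orient_pos hab (Or.inl h)).ne' hy
      rcases lt_or_gt_of_ne hne.2 with h' | h'
      · exact (hp.orient_neg h h').ne hy
      · exact (hp.orient_pos hab (Or.inr h')).ne' hy
    have hind : AffineIndependent ℝ
        ((↑) : (({p a, p b} : Finset (Fin 2 → ℝ)) : Set (Fin 2 → ℝ)) → Fin 2 → ℝ) := by
      have := (affineIndependent_of_ne ℝ ((hp.injective hm).ne hab.ne)).range
      rw [Matrix.range_cons, Matrix.range_cons, Matrix.range_empty, Set.union_empty] at this
      rwa [Finset.coe_pair]
    have hs : ∀ ρ : Finset (Fin m), (ρ ∩ {a, b}).image p ⊆ {p a, p b} := by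
      intro ρ y hy
      obtain ⟨z, hz, rfl⟩ := Finset.mem_image.1 hy
      rcases Finset.mem_insert.1 (Finset.mem_inter.1 hz).2 with rfl | hz
      · simp
      · simp [Finset.mem_singleton.1 hz]
    have hs1 : {y ∈ p '' (σ : Set (Fin m)) | orientAffine (p a) (p b) y = 0} ⊆
        ((σ ∩ {a, b}).image p : Finset (Fin 2 → ℝ)) := by
      rintro _ ⟨⟨y, hy, rfl⟩, hy0⟩
      have := hends y (by simpa using hy0)
      exact Finset.mem_image_of_mem _ (Finset.mem_inter.2 ⟨hy, by simpa using this⟩)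
    have hs2 : {y ∈ p '' (τ : Set (Fin m)) | (-orientAffine (p a) (p b)) y = 0} ⊆
        ((τ ∩ {a, b}).image p : Finset (Fin 2 → ℝ)) := by
      rintro _ ⟨⟨y, hy, rfl⟩, hy0⟩
      have := hends y (by simpa using hy0)
      exact Finset.mem_image_of_mem _ (Finset.mem_inter.2 ⟨hy, by simpa using this⟩)
    have h3 := (hind.convexHull_inter (hs σ) (hs τ)).ge
      ⟨convexHull_mono hs1 f1, convexHull_mono hs2 f2⟩
    refine convexHull_mono ?_ h3
    rw [← Finset.coe_inter, ← Finset.image_inter _ _ (hp.injective hm), ← Finset.coe_image]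
    refine Finset.coe_subset.2 (Finset.image_subset_image ?_)
    intro y
    simp +contextual
  · refine Set.subset_inter (convexHull_mono (Set.image_mono ?_))
      (convexHull_mono (Set.image_mono ?_)) <;> intro y <;> simp +contextual

end IsCcw

namespace IntervalTriangulation

variable {m : ℕ} {i j : Fin m} {t : Finset (Finset (Fin m))}

theorem lt (h : IntervalTriangulation i j t) : i < j := by
  cases h with
  | edge h => exact h.lt
  | node h1 h2 => exact h1.trans h2

theorem eq_triple (h : IntervalTriangulation i j t) {σ : Finset (Fin m)} (hσ : σ ∈ t) :
    ∃ a b c, i ≤ a ∧ a < b ∧ b < c ∧ c ≤ j ∧ σ = {a, b, c} := by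
  induction h with
  | edge h => simp at hσ
  | @node i k j t₁ t₂ hik hkj h₁ h₂ ih₁ ih₂ =>
    simp only [Finset.mem_insert, Finset.mem_union] at hσ
    rcases hσ with rfl | hσ | hσ
    · exact ⟨i, k, j, le_rfl, hik, hkj, le_rfl, rfl⟩
    · obtain ⟨a, b, c, h1, h2, h3, h4, rfl⟩ := ih₁ hσ
      exact ⟨a, b, c, h1, h2, h3, h4.trans hkj.le, rfl⟩
    · obtain ⟨a, b, c, h1, h2, h3, h4, rfl⟩ := ih₂ hσ
      exact ⟨a, b, c, hik.le.trans h1, h2, h3, h4, rfl⟩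

theorem mem_Icc (h : IntervalTriangulation i j t) {σ : Finset (Fin m)} (hσ : σ ∈ t) :
    ∀ x ∈ σ, i ≤ x ∧ x ≤ j := by
  obtain ⟨a, b, c, h1, h2, h3, h4, rfl⟩ := h.eq_triple hσ
  intro x hx
  simp only [Finset.mem_insert, Finset.mem_singleton] at hx
  rcases hx with rfl | rfl | rfl
  · exact ⟨h1, (h2.trans h3).le.trans h4⟩
  · exact ⟨h1.trans h2.le, h3.le.trans h4⟩
  · exact ⟨h1.trans (h2.trans h3).le, h4⟩

theorem exists_of_lt {i j : Fin m} (hij : i < j) : ∃ t, IntervalTriangulation i j t := by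
  by_cases h : i ⋖ j
  · exact ⟨_, edge h⟩
  · obtain ⟨k, hik, hkj⟩ := (not_covBy_iff hij).1 h
    obtain ⟨t₁, h₁⟩ := exists_of_lt hik
    obtain ⟨t₂, h₂⟩ := exists_of_lt hkj
    exact ⟨_, node hik hkj h₁ h₂⟩
termination_by j.val - i.val
decreasing_by all_goals simp only [Fin.lt_def] at *; omega

theorem sum_node {k : Fin m} {t₁ t₂ : Finset (Finset (Fin m))} (hik : i < k) (hkj : k < j)
    (h₁ : IntervalTriangulation i k t₁) (h₂ : IntervalTriangulation k j t₂)
    (g : Finset (Fin m) → ℝ) :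
    ∑ σ ∈ insert {i, k, j} (t₁ ∪ t₂), g σ = g {i, k, j} + (∑ σ ∈ t₁, g σ + ∑ σ ∈ t₂, g σ) := by
  rw [Finset.sum_insert, Finset.sum_union]
  · rw [Finset.disjoint_left]
    intro σ hσ₁ hσ₂
    obtain ⟨a, b, c, h1, h2, h3, h4, rfl⟩ := h₁.eq_triple hσ₁
    have := (h₂.mem_Icc hσ₂ b (by simp)).1
    exact absurd (h3.trans_le h4) (not_lt.2 this)
  · rw [Finset.mem_union, not_or]
    constructor
    · intro h
      exact absurd (h₁.mem_Icc h j (by simp)).2 (not_le.2 hkj)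
    · intro h
      exact absurd (h₂.mem_Icc h i (by simp)).1 (not_le.2 hik)

/-- The separating chord is a side of the root triangle at the step where the two triangles part. -/
theorem separated (h : IntervalTriangulation i j t) {σ τ : Finset (Fin m)} (hσ : σ ∈ t)
    (hτ : τ ∈ t) (hne : σ ≠ τ) :
    ∃ a b, a < b ∧
      (((∀ x ∈ σ, a ≤ x ∧ x ≤ b) ∧ ∀ x ∈ τ, x ≤ a ∨ b ≤ x) ∨
        ((∀ x ∈ τ, a ≤ x ∧ x ≤ b) ∧ ∀ x ∈ σ, x ≤ a ∨ b ≤ x)) := by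
  induction h with
  | edge h => simp at hσ
  | @node i k j t₁ t₂ hik hkj h₁ h₂ ih₁ ih₂ =>
    have hroot₁ : ∀ x ∈ ({i, k, j} : Finset (Fin m)), x ≤ i ∨ k ≤ x := by
      intro x hx
      simp only [Finset.mem_insert, Finset.mem_singleton] at hx
      rcases hx with rfl | rfl | rfl
      · exact Or.inl le_rfl
      · exact Or.inr le_rfl
      · exact Or.inr hkj.le
    have hroot₂ : ∀ x ∈ ({i, k, j} : Finset (Fin m)), x ≤ k ∨ j ≤ x := by
      intro x hx
      simp only [Finset.mem_insert, Finset.mem_singleton] at hx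
      rcases hx with rfl | rfl | rfl
      · exact Or.inl hik.le
      · exact Or.inl le_rfl
      · exact Or.inr le_rfl
    simp only [Finset.mem_insert, Finset.mem_union] at hσ hτ
    rcases hσ with rfl | hσ | hσ <;> rcases hτ with rfl | hτ | hτ
    · exact absurd rfl hne
    · exact ⟨i, k, hik, Or.inr ⟨h₁.mem_Icc hτ, hroot₁⟩⟩
    · exact ⟨k, j, hkj, Or.inr ⟨h₂.mem_Icc hτ, hroot₂⟩⟩
    · exact ⟨i, k, hik, Or.inl ⟨h₁.mem_Icc hσ, hroot₁⟩⟩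
    · exact ih₁ hσ hτ
    · exact ⟨i, k, hik, Or.inl ⟨h₁.mem_Icc hσ, fun x hx => Or.inr (h₂.mem_Icc hτ x hx).1⟩⟩
    · exact ⟨k, j, hkj, Or.inl ⟨h₂.mem_Icc hσ, hroot₂⟩⟩
    · exact ⟨i, k, hik, Or.inr ⟨h₁.mem_Icc hτ, fun x hx => Or.inr (h₂.mem_Icc hσ x hx).1⟩⟩
    · exact ih₂ hσ hτ

variable {p : Fin m → Fin 2 → ℝ}

theorem mem_triangle_image {i k j : Fin m} {x : Fin 2 → ℝ}
    (h : x ∈ convexHull ℝ {p i, p k, p j}) :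
    x ∈ convexHull ℝ (p '' (({i, k, j} : Finset (Fin m)) : Set (Fin m))) := by
  simpa [Set.image_insert_eq] using h

/-- A point beyond a side of the root triangle is sought in the part behind that side; a point
beyond neither side is in the root triangle. At an edge the two sign conditions contradict each
other. -/
theorem exists_mem (hp : IsCcw p) (h : IntervalTriangulation i j t) {x : Fin 2 → ℝ}
    (hx : ∀ a b, i ≤ a → a ⋖ b → b ≤ j → 0 ≤ orient (p a) (p b) x)
    (hji : 0 < orient (p j) (p i) x) :
    ∃ σ ∈ t, x ∈ convexHull ℝ (p '' (σ : Set (Fin m))) := by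
  induction h with
  | @edge i j h =>
    have := hx i j le_rfl h le_rfl
    have e : orient (p j) (p i) x = -orient (p i) (p j) x := orient_swap_left _ _ _
    linarith
  | @node i k j t₁ t₂ hik hkj h₁ h₂ ih₁ ih₂ =>
    by_cases c1 : 0 < orient (p k) (p i) x
    · obtain ⟨σ, hσ, h⟩ := ih₁ (fun a b ha hab hb => hx a b ha hab (hb.trans hkj.le)) c1
      exact ⟨σ, by simp [hσ], h⟩
    by_cases c2 : 0 < orient (p j) (p k) x
    · obtain ⟨σ, hσ, h⟩ := ih₂ (fun a b ha hab hb => hx a b (hik.le.trans ha) hab hb) c2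
      exact ⟨σ, by simp [hσ], h⟩
    refine ⟨_, Finset.mem_insert_self _ _, mem_triangle_image
      (mem_convexHull_of_orient (hp i k j hik hkj) ?_ ?_ hji.le)⟩
    · rw [orient_swap_left]; linarith
    · rw [orient_swap_left]; linarith

theorem isTriangulation {n : ℕ} {p : Fin (n + 3) → Fin 2 → ℝ} (hp : IsCcw p)
    {t : Finset (Finset (Fin (n + 3)))} (h : IntervalTriangulation 0 (Fin.last (n + 2)) t) :
    IsTriangulation p t := by
  have hm : 3 ≤ n + 3 := by omega
  constructor
  · intro σ hσ
    obtain ⟨a, b, c, -, h2, h3, -, rfl⟩ := h.eq_triple hσ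
    exact Finset.card_eq_three.2 ⟨a, b, c, h2.ne, (h2.trans h3).ne, h3.ne, rfl⟩
  · intro σ hσ
    obtain ⟨a, b, c, -, h2, h3, -, rfl⟩ := h.eq_triple hσ
    exact affineIndependent_of_orient_ne_zero (hp a b c h2 h3).ne'
  · apply Set.Subset.antisymm
    · exact Set.iUnion₂_subset fun σ _ => convexHull_mono (Set.image_subset_range _ _)
    · intro x hx
      have hside : ∀ a b, (∀ y, 0 ≤ orient (p a) (p b) (p y)) → 0 ≤ orient (p a) (p b) x := by
        intro a b hy
        have := convexHull_min (s := Set.range p) (t := {y | 0 ≤ orientAffine (p a) (p b) y})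
          (by rintro _ ⟨y, rfl⟩; simpa using hy y)
          ((convex_Ici (0 : ℝ)).affine_preimage (orientAffine (p a) (p b))) hx
        simpa using this
      have hx' : ∀ a b, a ⋖ b → 0 ≤ orient (p a) (p b) x := fun a b hab =>
        hside a b fun y => hp.orient_nonneg hab.lt (by
          by_contra! hc
          exact hab.2 hc.1 hc.2)
      have hx0 : 0 ≤ orient (p (Fin.last (n + 2))) (p 0) x := hside _ _ fun y => by
        rw [orient_swap_left]
        have := hp.orient_nonpos (Fin.zero_le y) (Fin.le_last y)
        linarith
      simp only [Set.mem_iUnion, exists_prop]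
      cases h with
      | edge h =>
        exact absurd (h.2 (c := 1) (by simp) (by simp [Fin.lt_def])) id
      | @node _ k _ t₁ t₂ hik hkj h₁ h₂ =>
        by_cases c1 : 0 < orient (p k) (p 0) x
        · obtain ⟨σ, hσ, h⟩ := h₁.exists_mem hp (fun a b _ hab _ => hx' a b hab) c1
          exact ⟨σ, by simp [hσ], h⟩
        by_cases c2 : 0 < orient (p (Fin.last (n + 2))) (p k) x
        · obtain ⟨σ, hσ, h⟩ := h₂.exists_mem hp (fun a b _ hab _ => hx' a b hab) c2
          exact ⟨σ, by simp [hσ], h⟩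
        refine ⟨_, Finset.mem_insert_self _ _, mem_triangle_image
          (mem_convexHull_of_orient (hp _ _ _ hik hkj) ?_ ?_ hx0)⟩
        · rw [orient_swap_left]; linarith
        · rw [orient_swap_left]; linarith
  · intro σ hσ τ hτ
    by_cases hne : σ = τ
    · subst hne; simp
    obtain ⟨a, b, hab, ⟨h1, h2⟩ | ⟨h1, h2⟩⟩ := h.separated hσ hτ hne
    · exact hp.inter_eq hm hab h1 h2
    · rw [Set.inter_comm, Finset.inter_comm]
      exact hp.inter_eq hm hab h1 h2

end IntervalTriangulation

/-! ### Functionals bent along a diagonal -/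

/-- A concave piecewise linear function bent along the line through `a` and `b`. -/
def bend (a b x : Fin 2 → ℝ) : ℝ := min (orient a b x) 0

theorem continuous_orient (a b : Fin 2 → ℝ) : Continuous fun x => orient a b x := by
  unfold orient; fun_prop

theorem continuous_bend (a b : Fin 2 → ℝ) : Continuous (bend a b) :=
  (continuous_orient a b).min continuous_const

theorem concaveOn_affine {E : Type*} [AddCommGroup E] [Module ℝ E] (f : E →ᵃ[ℝ] ℝ) {s : Set E}
    (hs : Convex ℝ s) : ConcaveOn ℝ s f :=
  ⟨hs, fun _ _ _ _ _ _ _ _ hab => (Convex.combo_affine_apply (f := f) hab).ge⟩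

theorem convexOn_affine {E : Type*} [AddCommGroup E] [Module ℝ E] (f : E →ᵃ[ℝ] ℝ) {s : Set E}
    (hs : Convex ℝ s) : ConvexOn ℝ s f :=
  ⟨hs, fun _ _ _ _ _ _ _ _ hab => (Convex.combo_affine_apply (f := f) hab).le⟩

theorem concaveOn_bend (a b : Fin 2 → ℝ) : ConcaveOn ℝ Set.univ (bend a b) := by
  have h := (concaveOn_affine (orientAffine a b) convex_univ).inf
    (concaveOn_const (0 : ℝ) convex_univ)
  refine h.congr fun x _ => ?_
  simp [bend]

theorem secondaryPolytope_sum_affine {m : ℕ} {q : Fin m → Fin 2 → ℝ} (f : (Fin 2 → ℝ) →ᵃ[ℝ] ℝ) :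
    ∃ c, ∀ v ∈ secondaryPolytope q, ∑ i, f (q i) * v i = c :=
  ⟨_, fun _ hv => secondaryPolytope_sum_eq f.continuous_of_finiteDimensional
    (concaveOn_affine f convex_univ) (convexOn_affine f convex_univ) hv⟩

/-- Pairing a vector with the values of `bend` on the vertices. -/
def bendFunctional {m : ℕ} (p : Fin m → Fin 2 → ℝ) (a b : Fin m) : (Fin m → ℝ) →ₗ[ℝ] ℝ :=
  ∑ i, bend (p a) (p b) (p i) • LinearMap.proj i

theorem bendFunctional_apply {m : ℕ} (p : Fin m → Fin 2 → ℝ) (a b : Fin m) (v : Fin m → ℝ) :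
    bendFunctional p a b v = ∑ i, bend (p a) (p b) (p i) * v i := by
  simp [bendFunctional]

/-- The maximum of `bendFunctional` on the secondary polytope. -/
noncomputable def bendMax {m : ℕ} (p : Fin m → Fin 2 → ℝ) (a b : Fin m) : ℝ :=
  3 * ∫ x in convexHull ℝ (Set.range p), bend (p a) (p b) x

theorem bendFunctional_le {m : ℕ} {p : Fin m → Fin 2 → ℝ} (a b : Fin m) {v : Fin m → ℝ}
    (hv : v ∈ secondaryPolytope p) : bendFunctional p a b v ≤ bendMax p a b := by
  rw [bendFunctional_apply]
  exact secondaryPolytope_sum_le (continuous_bend _ _) (concaveOn_bend _ _) hv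

namespace IsCcw

variable {m : ℕ} {p : Fin m → Fin 2 → ℝ}

theorem bend_inside (hp : IsCcw p) {a b x : Fin m} (h1 : a ≤ x) (h2 : x ≤ b) :
    bend (p a) (p b) (p x) = orient (p a) (p b) (p x) :=
  min_eq_left (hp.orient_nonpos h1 h2)

theorem bend_outside (hp : IsCcw p) {a b x : Fin m} (hab : a < b) (h : x ≤ a ∨ b ≤ x) :
    bend (p a) (p b) (p x) = 0 :=
  min_eq_right (hp.orient_nonneg hab h)

/-- Each triangle lies on one side of the chord, where `bend` is either `orient` or zero. Being
affine on every triangle, it attains equality in the integral bound. -/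
theorem bendFunctional_gkzVector (hp : IsCcw p) {a b : Fin m} (hab : a < b)
    {t : Finset (Finset (Fin m))} (ht : IsTriangulation p t) (hcr : NotCrossing t a b) :
    bendFunctional p a b (gkzVector p t) = bendMax p a b := by
  rw [bendFunctional_apply]
  have hpiece : ∀ σ ∈ t, ∃ f : (Fin 2 → ℝ) →ᵃ[ℝ] ℝ,
      Set.EqOn f (bend (p a) (p b)) (convexHull ℝ (p '' (σ : Set (Fin m)))) := by
    intro σ hσ
    rcases hcr σ hσ with h | h
    · refine ⟨orientAffine (p a) (p b), fun x hx => ?_⟩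
      have : orientAffine (p a) (p b) x ≤ 0 := by
        refine convexHull_min (t := {y | orientAffine (p a) (p b) y ≤ 0}) ?_
          ((convex_Iic (0 : ℝ)).affine_preimage (orientAffine (p a) (p b))) hx
        rintro _ ⟨y, hy, rfl⟩
        simpa using hp.orient_nonpos (h y hy).1 (h y hy).2
      rw [orientAffine_apply] at this ⊢
      exact (min_eq_left this).symm
    · refine ⟨0, fun x hx => ?_⟩
      have : 0 ≤ orientAffine (p a) (p b) x := by
        refine convexHull_min (t := {y | 0 ≤ orientAffine (p a) (p b) y}) ?_
          ((convex_Ici (0 : ℝ)).affine_preimage (orientAffine (p a) (p b))) hx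
        rintro _ ⟨y, hy, rfl⟩
        simpa using hp.orient_nonneg hab (h y hy)
      rw [orientAffine_apply] at this
      exact (min_eq_right this).symm
  refine ht.sum_mul_gkzVector_eq (continuous_bend _ _) (fun σ hσ => ?_) fun σ hσ => ?_
  · obtain ⟨f, hf⟩ := hpiece σ hσ
    exact (concaveOn_affine f (convex_convexHull _ _)).congr hf
  · obtain ⟨f, hf⟩ := hpiece σ hσ
    exact (convexOn_affine f (convex_convexHull _ _)).congr hf

/-- A nonpositive function on the vertices of a polygon, supported on the open interval `(i, j)`,
is a nonnegative combination of functions bent along the edges of a triangulation. -/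
theorem exists_eq_sum_bend (hp : IsCcw p) {i j : Fin m} (hij : i < j) (w : Fin m → ℝ)
    (hw : ∀ x, w x ≤ 0) (hsupp : ∀ x, w x ≠ 0 → i < x ∧ x < j) :
    ∃ t, IntervalTriangulation i j t ∧ ∃ c : Fin m → Fin m → ℝ,
      (∀ a b, 0 ≤ c a b) ∧
      (∀ a b, c a b ≠ 0 → i ≤ a ∧ a < b ∧ b ≤ j ∧ NotCrossing t a b) ∧
      ∀ x, w x = ∑ a, ∑ b, c a b * bend (p a) (p b) (p x) := by
  by_cases hcov : i ⋖ j
  · refine ⟨_, .edge hcov, 0, by simp, by simp, fun x => ?_⟩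
    by_contra h
    have := hsupp x (by simpa using h)
    exact hcov.2 this.1 this.2
  have hne : (Finset.Ioo i j).Nonempty := by
    obtain ⟨k, hk⟩ := (not_covBy_iff hij).1 hcov
    exact ⟨k, Finset.mem_Ioo.2 hk⟩
  -- The minimal ratio `l` is the largest multiple of the bend along `i j` that can be subtracted
  -- while keeping the function nonpositive. The remainder vanishes at `k`, so it splits into parts
  -- supported on `(i, k)` and `(k, j)`, to which recursion applies.
  obtain ⟨k, hk, hmin⟩ := (Finset.Ioo i j).exists_min_image
    (fun x => w x / orient (p i) (p j) (p x)) hne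
  obtain ⟨hik, hkj⟩ := Finset.mem_Ioo.1 hk
  set l := w k / orient (p i) (p j) (p k) with hl
  have hl0 : 0 ≤ l := div_nonneg_of_nonpos (hw k) (hp.orient_neg hik hkj).le
  set w' : Fin m → ℝ := fun x => w x - l * bend (p i) (p j) (p x) with hw'
  have hw'out : ∀ x, ¬ (i < x ∧ x < j) → w' x = 0 := by
    intro x hx
    have h1 : w x = 0 := by by_contra h; exact hx (hsupp x h)
    have h2 : x ≤ i ∨ j ≤ x := by
      by_contra! h; exact hx h
    simp [hw', h1, hp.bend_outside hij h2]
  have hw'le : ∀ x, w' x ≤ 0 := by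
    intro x
    by_cases hx : i < x ∧ x < j
    · have h1 := hmin x (Finset.mem_Ioo.2 hx)
      have h2 := hp.orient_neg hx.1 hx.2
      simp only [hw', hp.bend_inside hx.1.le hx.2.le]
      rw [le_div_iff_of_neg h2] at h1
      linarith
    · exact (hw'out x hx).le
  have hw'k : w' k = 0 := by
    simp only [hw', hp.bend_inside hik.le hkj.le, hl]
    rw [div_mul_cancel₀ _ (hp.orient_neg hik hkj).ne, sub_self]
  obtain ⟨t₁, ht₁, c₁, hc₁, hc₁', hs₁⟩ := exists_eq_sum_bend hp hik
    (fun x => if i < x ∧ x < k then w' x else 0)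
    (fun x => by split_ifs; exacts [hw'le x, le_rfl])
    (fun x hx => by by_contra h; simp [h] at hx)
  obtain ⟨t₂, ht₂, c₂, hc₂, hc₂', hs₂⟩ := exists_eq_sum_bend hp hkj
    (fun x => if k < x ∧ x < j then w' x else 0)
    (fun x => by split_ifs; exacts [hw'le x, le_rfl])
    (fun x hx => by by_contra h; simp [h] at hx)
  have hroot : ∀ x ∈ ({i, k, j} : Finset (Fin m)), x = i ∨ x = k ∨ x = j := by
    intro x hx; simpa using hx
  refine ⟨_, .node hik hkj ht₁ ht₂,
    fun a b => c₁ a b + c₂ a b + if a = i ∧ b = j then l else 0, fun a b => ?_, fun a b h => ?_,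
    fun x => ?_⟩
  · have := hc₁ a b
    have := hc₂ a b
    dsimp only
    split_ifs <;> linarith
  · by_cases h1 : c₁ a b = 0
    · by_cases h2 : c₂ a b = 0
      · have h3 : a = i ∧ b = j := by by_contra h3; simp [h1, h2, h3] at h
        obtain ⟨rfl, rfl⟩ := h3
        refine ⟨le_rfl, hij, le_rfl, fun σ hσ => Or.inl fun x hx => ?_⟩
        exact (IntervalTriangulation.node hik hkj ht₁ ht₂).mem_Icc hσ x hx
      · obtain ⟨ha, hab, hb, hcr⟩ := hc₂' a b h2
        refine ⟨hik.le.trans ha, hab, hb, fun σ hσ => ?_⟩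
        simp only [Finset.mem_insert, Finset.mem_union] at hσ
        rcases hσ with rfl | hσ | hσ
        · refine Or.inr fun x hx => ?_
          rcases hroot x hx with rfl | rfl | rfl
          · exact Or.inl (hik.le.trans ha)
          · exact Or.inl ha
          · exact Or.inr hb
        · exact Or.inr fun x hx => Or.inl ((ht₁.mem_Icc hσ x hx).2.trans ha)
        · exact hcr σ hσ
    · obtain ⟨ha, hab, hb, hcr⟩ := hc₁' a b h1
      refine ⟨ha, hab, hb.trans hkj.le, fun σ hσ => ?_⟩
      simp only [Finset.mem_insert, Finset.mem_union] at hσ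
      rcases hσ with rfl | hσ | hσ
      · refine Or.inr fun x hx => ?_
        rcases hroot x hx with rfl | rfl | rfl
        · exact Or.inl ha
        · exact Or.inr hb
        · exact Or.inr (hb.trans hkj.le)
      · exact hcr σ hσ
      · exact Or.inr fun x hx => Or.inr (hb.trans (ht₂.mem_Icc hσ x hx).1)
  · have hsplit : w x = (if i < x ∧ x < k then w' x else 0) +
        (if k < x ∧ x < j then w' x else 0) + l * bend (p i) (p j) (p x) := by
      have : w x = w' x + l * bend (p i) (p j) (p x) := by simp [hw']
      rw [this]
      congr 1
      by_cases hx : i < x ∧ x < j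
      · rcases lt_trichotomy x k with h | h | h
        · simp [h, hx.1, h.le]
        · simp [h, hw'k]
        · simp [h, hx.2, h.le]
      · rw [hw'out x hx]; simp
    rw [hsplit, hs₁ x, hs₂ x]
    simp only [add_mul, Finset.sum_add_distrib, ite_mul, zero_mul, ite_and]
    congr 1
    rw [Finset.sum_eq_single i, Finset.sum_eq_single j] <;> simp +contextual
termination_by j.val - i.val
decreasing_by all_goals simp only [Fin.lt_def] at *; omega

end IsCcw

/-! ### Facets of the secondary polytope -/

/-- Every affine functional constant on the face of `P` where `φ` is maximal is, on `P`, an affine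
function of `φ`; for a polytope and `φ` not constant on it, this says that the face is a facet. -/
def IsFacetFunctional {E : Type*} [AddCommGroup E] [Module ℝ E] (P : Set E) (φ : E →ᵃ[ℝ] ℝ) :
    Prop :=
  ∀ u : E →ᵃ[ℝ] ℝ, (∃ c, ∀ x ∈ P, (∀ y ∈ P, φ y ≤ φ x) → u x = c) →
    ∃ a b : ℝ, ∀ x ∈ P, u x = a * φ x + b

/-- The polytope `P` has a pair of parallel facets. -/
def HasParallelFacets {E : Type*} [AddCommGroup E] [Module ℝ E] (P : Set E) : Prop :=
  ∃ φ : E →ᵃ[ℝ] ℝ, (∃ x ∈ P, ∃ y ∈ P, φ x ≠ φ y) ∧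
    IsFacetFunctional P φ ∧ IsFacetFunctional P (-φ)

/-- The areas are the coefficients of the affine dependence between four points of the plane, and an
affine function respects it. -/
theorem orient_relation (a b c d : Fin 2 → ℝ) (f : (Fin 2 → ℝ) →ᵃ[ℝ] ℝ) :
    f a * orient b c d - f b * orient a c d + f c * orient a b d - f d * orient a b c = 0 := by
  have hf : ∀ x : Fin 2 → ℝ, f x =
      f.linear (Pi.single 0 1) * x 0 + f.linear (Pi.single 1 1) * x 1 + f 0 := by
    intro x
    have h1 : f x = f.linear x + f 0 := by
      have := f.map_vadd 0 x
      simpa using this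
    have h2 : x = x 0 • Pi.single 0 1 + x 1 • Pi.single 1 1 := by
      ext i; fin_cases i <;> simp
    rw [h1]
    nth_rewrite 1 [h2]
    rw [map_add, map_smul, map_smul, smul_eq_mul, smul_eq_mul]
    ring
  rw [hf a, hf b, hf c, hf d]
  unfold orient
  ring

namespace IsCcw

/-- Subtracting such an `f` from `w` changes the functional by a constant and leaves a nonpositive
function vanishing at both ends, as the decomposition into bends requires. -/
theorem exists_affine_majorant {n : ℕ} {p : Fin (n + 3) → Fin 2 → ℝ} (hp : IsCcw p)
    (w : Fin (n + 3) → ℝ) :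
    ∃ f : (Fin 2 → ℝ) →ᵃ[ℝ] ℝ, f (p 0) = w 0 ∧ f (p (Fin.last (n + 2))) = w (Fin.last (n + 2)) ∧
      ∀ x, w x ≤ f (p x) := by
  set z := Fin.last (n + 2)
  have h1z : (0 : Fin (n + 3)) < 1 ∧ 1 < z := by
    constructor <;> simp [z, Fin.lt_def]
  have h0z : 0 < z := h1z.1.trans h1z.2
  have hpos : 0 < orient (p 0) (p 1) (p z) := hp 0 1 z h1z.1 h1z.2
  set f₀ : (Fin 2 → ℝ) →ᵃ[ℝ] ℝ :=
    ((w z - w 0) / orient (p 0) (p 1) (p z)) • orientAffine (p 0) (p 1) +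
      AffineMap.const ℝ _ (w 0) with hf₀
  have e0 : f₀ (p 0) = w 0 := by simp [hf₀, orient_self_outer]
  have ez : f₀ (p z) = w z := by simp [hf₀, div_mul_cancel₀ _ hpos.ne']
  -- Subtracting `c` times `orient` along `0 z` fixes the two ends and raises the other vertices,
  -- where `orient` is negative. The ratios at the ends have denominator zero and are harmless,
  -- since the ends are treated separately.
  obtain ⟨c, hc⟩ := (Set.finite_range fun x =>
    (f₀ (p x) - w x) / orient (p 0) (p z) (p x)).bddAbove
  refine ⟨f₀ - c • orientAffine (p 0) (p z), ?_, ?_, fun x => ?_⟩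
  · simp [e0, orient_self_outer]
  · simp [ez, orient_self_right]
  · rcases (Fin.zero_le x).eq_or_lt with rfl | h0
    · simp [e0, orient_self_outer]
    rcases (Fin.le_last x).eq_or_lt with hx | hx
    · rw [hx]; simp [z, ez, orient_self_right]
    · have h := hc ⟨x, rfl⟩
      have hneg := hp.orient_neg h0 hx
      rw [div_le_iff_of_neg hneg] at h
      simp only [AffineMap.coe_sub, AffineMap.coe_smul, Pi.sub_apply, Pi.smul_apply,
        orientAffine_apply, smul_eq_mul]
      linarith

/-- A functional with a facet as its maximal face is a multiple of a bend functional. -/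
theorem exists_eq_bendFunctional {n : ℕ} {p : Fin (n + 3) → Fin 2 → ℝ} (hp : IsCcw p)
    {φ : (Fin (n + 3) → ℝ) →ᵃ[ℝ] ℝ}
    (hφ : ∃ x ∈ secondaryPolytope p, ∃ y ∈ secondaryPolytope p, φ x ≠ φ y)
    (hfac : IsFacetFunctional (secondaryPolytope p) φ) :
    ∃ a b, a < b ∧ ∃ α β : ℝ, 0 < α ∧
      ∀ v ∈ secondaryPolytope p, φ v = α * bendFunctional p a b v + β := by
  set A := secondaryPolytope p with hA
  set w : Fin (n + 3) → ℝ := fun i => φ.linear (Pi.single i 1) with hw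
  have hφw : ∀ v, φ v = ∑ i, w i * v i + φ 0 := by
    intro v
    have h1 : φ v = φ.linear v + φ 0 := by
      have := φ.map_vadd 0 v
      simpa using this
    rw [h1, LinearMap.pi_apply_eq_sum_univ φ.linear v]
    congr 1
    refine Finset.sum_congr rfl fun i _ => ?_
    rw [smul_eq_mul, mul_comm]
    congr 2
    ext j
    simp [Pi.single_apply, eq_comm]
  obtain ⟨f, hf0, hfz, hf⟩ := hp.exists_affine_majorant w
  obtain ⟨t, ht, c, hc, hc', hs⟩ := hp.exists_eq_sum_bend
    (i := 0) (j := Fin.last (n + 2)) (by simp [Fin.lt_def]) (fun x => w x - f (p x))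
    (fun x => by linarith [hf x]) (fun x hx => by
      refine ⟨lt_of_le_of_ne (Fin.zero_le x) ?_, lt_of_le_of_ne (Fin.le_last x) ?_⟩
      · rintro rfl; simp [hf0] at hx
      · rintro rfl; simp [hfz] at hx)
  obtain ⟨K, hK⟩ := secondaryPolytope_sum_affine (q := p) f
  have hrep : ∀ v ∈ A, φ v = (K + φ 0) + ∑ a, ∑ b, c a b * bendFunctional p a b v := by
    intro v hv
    have h1 : ∀ i, w i = f (p i) + ∑ a, ∑ b, c a b * bend (p a) (p b) (p i) := fun i => by
      rw [← hs i]; ring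
    have h2 : ∑ i, (∑ a, ∑ b, c a b * bend (p a) (p b) (p i)) * v i =
        ∑ a, ∑ b, c a b * bendFunctional p a b v := by
      simp only [bendFunctional_apply, Finset.sum_mul, Finset.mul_sum]
      rw [Finset.sum_comm]
      refine Finset.sum_congr rfl fun a _ => ?_
      rw [Finset.sum_comm]
      exact Finset.sum_congr rfl fun b _ => Finset.sum_congr rfl fun i _ => by ring
    rw [hφw, Finset.sum_congr rfl fun i _ => by rw [h1 i, add_mul], Finset.sum_add_distrib,
      hK v hv, h2]
    ring
  have htri := ht.isTriangulation hp
  have hv₀ : gkzVector p t ∈ A := subset_convexHull ℝ _ ⟨t, htri, rfl⟩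
  have hmax : ∀ a b, c a b ≠ 0 → bendFunctional p a b (gkzVector p t) = bendMax p a b :=
    fun a b h => hp.bendFunctional_gkzVector (hc' a b h).2.1 htri (hc' a b h).2.2.2
  have hterm : ∀ a b, ∀ v ∈ A, c a b * bendFunctional p a b v ≤
      c a b * bendFunctional p a b (gkzVector p t) := by
    intro a b v hv
    by_cases h : c a b = 0
    · simp [h]
    · rw [hmax a b h]
      exact mul_le_mul_of_nonneg_left (bendFunctional_le a b hv) (hc a b)
  have hφmax : ∀ v ∈ A, φ v ≤ φ (gkzVector p t) := by
    intro v hv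
    rw [hrep v hv, hrep _ hv₀]
    exact add_le_add le_rfl
      (Finset.sum_le_sum fun a _ => Finset.sum_le_sum fun b _ => hterm a b v hv)
  -- Since `φ` is not constant, some bend with nonzero coefficient is not constant either.
  obtain ⟨a, b, hcab, x₁, hx₁, x₂, hx₂, hne⟩ : ∃ a b, c a b ≠ 0 ∧ ∃ x ∈ A, ∃ y ∈ A,
      bendFunctional p a b x ≠ bendFunctional p a b y := by
    by_contra! hcon
    obtain ⟨x, hx, y, hy, hxy⟩ := hφ
    apply hxy
    rw [hrep x hx, hrep y hy]
    congr 1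
    refine Finset.sum_congr rfl fun a _ => Finset.sum_congr rfl fun b _ => ?_
    by_cases h : c a b = 0
    · simp [h]
    · rw [hcon a b h x hx y hy]
  -- All bends with nonzero coefficient are maximal at the vertex given by `t`. So `φ` is maximal
  -- only where each of them is, and this bend is constant on the maximal face of `φ`.
  obtain ⟨r, s, hrs⟩ := hfac (bendFunctional p a b).toAffineMap ⟨bendMax p a b, by
    intro x hx hxmax
    have h1 := hxmax _ hv₀
    rw [hrep _ hv₀, hrep x hx] at h1
    by_contra hlt
    have hlt' : c a b * bendFunctional p a b x <
        c a b * bendFunctional p a b (gkzVector p t) := by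
      rw [hmax a b hcab]
      exact mul_lt_mul_of_pos_left (lt_of_le_of_ne (bendFunctional_le a b hx) hlt)
        (lt_of_le_of_ne (hc a b) (Ne.symm hcab))
    have : ∑ a, ∑ b, c a b * bendFunctional p a b x <
        ∑ a, ∑ b, c a b * bendFunctional p a b (gkzVector p t) :=
      Finset.sum_lt_sum (fun a _ => Finset.sum_le_sum fun b _ => hterm a b x hx)
        ⟨a, Finset.mem_univ _, Finset.sum_lt_sum (fun b _ => hterm a b x hx)
          ⟨b, Finset.mem_univ _, hlt'⟩⟩
    linarith⟩
  simp only [LinearMap.coe_toAffineMap] at hrs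
  -- With `r ≤ 0` the bend would be minimal, as well as maximal, at the vertex given by `t`, hence
  -- constant.
  have hr0 : 0 < r := by
    by_contra! hr
    have hconst : ∀ v ∈ A, bendFunctional p a b v = bendMax p a b := by
      intro v hv
      refine le_antisymm (bendFunctional_le a b hv) ?_
      rw [← hmax a b hcab, hrs v hv, hrs _ hv₀]
      have := mul_le_mul_of_nonpos_left (hφmax v hv) hr
      linarith
    exact hne ((hconst _ hx₁).trans (hconst _ hx₂).symm)
  refine ⟨a, b, (hc' a b hcab).2.1, 1 / r, -(s / r), by positivity, fun v hv => ?_⟩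
  rw [hrs v hv]
  field_simp
  ring

/-- Along an edge of the polygon the bend is zero or affine on all vertices, and its functional is
constant on the polytope. -/
theorem exists_inside_outside {n : ℕ} {p : Fin (n + 3) → Fin 2 → ℝ} (hp : IsCcw p)
    {a b : Fin (n + 3)} (hab : a < b)
    (h : ∃ x ∈ secondaryPolytope p, ∃ y ∈ secondaryPolytope p,
      bendFunctional p a b x ≠ bendFunctional p a b y) :
    (∃ x, a < x ∧ x < b) ∧ ∃ y, y < a ∨ b < y := by
  obtain ⟨v, hv, v', hv', hne⟩ := h
  constructor
  · by_contra! hcon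
    have : ∀ u, bendFunctional p a b u = 0 := fun u => by
      rw [bendFunctional_apply]
      refine Finset.sum_eq_zero fun x _ => ?_
      rw [hp.bend_outside hab, zero_mul]
      by_contra! hx
      exact absurd (hcon x hx.1) (not_le.2 hx.2)
    exact hne (by rw [this, this])
  · by_contra! hcon
    obtain ⟨K, hK⟩ := secondaryPolytope_sum_affine (q := p) (orientAffine (p a) (p b))
    have : ∀ u ∈ secondaryPolytope p, bendFunctional p a b u = K := fun u hu => by
      rw [bendFunctional_apply, ← hK u hu]
      refine Finset.sum_congr rfl fun x _ => ?_
      rw [hp.bend_inside (hcon x).1 (hcon x).2, orientAffine_apply]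
    exact hne (by rw [this v hv, this v' hv'])

/-- Invariance of a functional under the flip in the quadrilateral `0, 1, 2, k`. -/
theorem flip_relation {n : ℕ} {p : Fin (n + 3) → Fin 2 → ℝ} (hp : IsCcw p)
    {F : Fin (n + 3) → ℝ} {K : ℝ} (hF : ∀ v ∈ secondaryPolytope p, ∑ i, F i * v i = K)
    {k : Fin (n + 3)} (hk : 2 < k) :
    F 0 * orient (p 1) (p 2) (p k) - F 1 * orient (p 0) (p 2) (p k) +
      F 2 * orient (p 0) (p 1) (p k) - F k * orient (p 0) (p 1) (p 2) = 0 := by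
  set g : Finset (Fin (n + 3)) → ℝ := fun σ =>
    (MeasureTheory.volume (convexHull ℝ (p '' (σ : Set (Fin (n + 3)))))).toReal * ∑ i ∈ σ, F i
    with hg
  have hgt : ∀ t, IntervalTriangulation 0 (Fin.last (n + 2)) t → ∑ σ ∈ t, g σ = K := by
    intro t ht
    rw [← hF _ (subset_convexHull ℝ _ ⟨t, ht.isTriangulation hp, rfl⟩),
      IsTriangulation.sum_mul_gkzVector]
  have h01 : (0 : Fin (n + 3)) < 1 := by simp
  have h12 : (1 : Fin (n + 3)) < 2 := by
    rw [Fin.lt_def]; simp [Nat.mod_eq_of_lt]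
  have c01 : (0 : Fin (n + 3)) ⋖ 1 := by
    refine ⟨h01, fun x h1 h2 => ?_⟩
    simp only [Fin.lt_def, Fin.val_one, Fin.val_zero] at h1 h2; omega
  have c12 : (1 : Fin (n + 3)) ⋖ 2 := by
    refine ⟨h12, fun x h1 h2 => ?_⟩
    simp only [Fin.lt_def, Fin.val_one, Fin.val_two] at h1 h2; omega
  have h1k := h12.trans hk
  have h02 := h01.trans h12
  have h0k := h01.trans h1k
  -- A triangulation of the vertices `0, …, k` is completed by the same triangles beyond the chord
  -- `0 k`, so its own contribution is constant too.
  have hext : ∃ C, ∀ t, IntervalTriangulation 0 k t → ∑ σ ∈ t, g σ = C := by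
    rcases (Fin.le_last k).eq_or_lt with rfl | hlt
    · exact ⟨K, hgt⟩
    · obtain ⟨r, hr⟩ := IntervalTriangulation.exists_of_lt hlt
      refine ⟨K - g {0, k, Fin.last (n + 2)} - ∑ σ ∈ r, g σ, fun t ht => ?_⟩
      have := hgt _ (.node h0k hlt ht hr)
      rw [IntervalTriangulation.sum_node h0k hlt ht hr] at this
      linarith
  obtain ⟨C, hC⟩ := hext
  obtain ⟨r, hr⟩ := IntervalTriangulation.exists_of_lt hk
  have s1 := hC _ (.node h02 hk (.node h01 h12 (.edge c01) (.edge c12)) hr)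
  have s2 := hC _ (.node h01 h1k (.edge c01) (.node h12 hk (.edge c12) hr))
  rw [IntervalTriangulation.sum_node h02 hk (.node h01 h12 (.edge c01) (.edge c12)) hr,
    IntervalTriangulation.sum_node h01 h12 (.edge c01) (.edge c12)] at s1
  rw [IntervalTriangulation.sum_node h01 h1k (.edge c01) (.node h12 hk (.edge c12) hr),
    IntervalTriangulation.sum_node h12 hk (.edge c12) hr] at s2
  set κ := (MeasureTheory.volume stdTriangle).toReal with hκ
  have hgval : ∀ a b c, a < b → b < c →
      g {a, b, c} = orient (p a) (p b) (p c) * κ * (F a + F b + F c) := by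
    intro a b c hab hbc
    have hpos := hp a b c hab hbc
    simp only [hg]
    rw [Finset.sum_insert (by simp [hab.ne, (hab.trans hbc).ne]),
      Finset.sum_insert (by simp [hbc.ne]), Finset.sum_singleton, ← add_assoc]
    have him : p '' (({a, b, c} : Finset (Fin (n + 3))) : Set (Fin (n + 3))) =
        {p a, p b, p c} := by simp [Set.image_insert_eq]
    rw [him, volume_triangle hpos.ne', abs_of_pos hpos]
  simp only [Finset.sum_empty, add_zero] at s1 s2
  rw [hgval _ _ _ h02 hk, hgval _ _ _ h01 h12] at s1
  rw [hgval _ _ _ h01 h1k, hgval _ _ _ h12 hk] at s2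
  -- The area of the quadrilateral, computed with either diagonal.
  have hid : orient (p 0) (p 1) (p 2) + orient (p 0) (p 2) (p k) =
      orient (p 0) (p 1) (p k) + orient (p 1) (p 2) (p k) := by unfold orient; ring
  refine (mul_eq_zero.1 (?_ : κ * _ = 0)).resolve_left volume_stdTriangle_pos.ne'
  linear_combination s1 - s2 - κ * (F 0 + F 1 + F 2 + F k) * hid

/-- The quadrilaterals `0, 1, 2, k` already suffice: they force each `F k` to be the value at `p k`
of the affine function that interpolates `F 0`, `F 1`, `F 2`. -/
theorem relation_of_const {n : ℕ} {p : Fin (n + 3) → Fin 2 → ℝ} (hp : IsCcw p)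
    {F : Fin (n + 3) → ℝ} {K : ℝ} (hF : ∀ v ∈ secondaryPolytope p, ∑ i, F i * v i = K)
    (i j k l : Fin (n + 3)) :
    F i * orient (p j) (p k) (p l) - F j * orient (p i) (p k) (p l) +
      F k * orient (p i) (p j) (p l) - F l * orient (p i) (p j) (p k) = 0 := by
  have h01 : (0 : Fin (n + 3)) < 1 := by simp
  have h12 : (1 : Fin (n + 3)) < 2 := by
    rw [Fin.lt_def]; simp [Nat.mod_eq_of_lt]
  have hpos := hp 0 1 2 h01 h12
  have hall : ∀ x, F 0 * orient (p 1) (p 2) (p x) - F 1 * orient (p 0) (p 2) (p x) +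
      F 2 * orient (p 0) (p 1) (p x) - F x * orient (p 0) (p 1) (p 2) = 0 := by
    intro x
    by_cases hx : 2 < x
    · exact hp.flip_relation hF hx
    · have hx' : x = 0 ∨ x = 1 ∨ x = 2 := by
        simp only [Fin.lt_def, Fin.ext_iff, Fin.val_zero, Fin.val_one, Fin.val_two] at hx ⊢
        omega
      rcases hx' with rfl | rfl | rfl <;> unfold orient <;> ring
  let f : (Fin 2 → ℝ) →ᵃ[ℝ] ℝ := (orient (p 0) (p 1) (p 2))⁻¹ •
    (F 0 • orientAffine (p 1) (p 2) - F 1 • orientAffine (p 0) (p 2) +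
      F 2 • orientAffine (p 0) (p 1))
  have hf : ∀ x, F x = f (p x) := by
    intro x
    simp only [f, AffineMap.coe_smul, AffineMap.coe_add, AffineMap.coe_sub, Pi.smul_apply,
      Pi.add_apply, Pi.sub_apply, orientAffine_apply, smul_eq_mul]
    rw [inv_mul_eq_div, eq_div_iff hpos.ne']
    linarith [hall x]
  rw [hf i, hf j, hf k, hf l]
  exact orient_relation _ _ _ _ f

end IsCcw

/-! ### Absence of parallel facets in type I -/

/-- The sum of two functions bent along the lines `a b` and `c e` is not affine on `a`, `b`, `x`,
`y` if `a b` separates `x` from `y` and `c e` does not cut the quadrilateral. -/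
theorem relation_ne_zero_of_separated {a b c e x y : Fin 2 → ℝ} {α β : ℝ} (hα : 0 < α)
    {H : (Fin 2 → ℝ) → ℝ} (hH : ∀ z, H z = α * |orient a b z| + β * |orient c e z|)
    (hrel : H a * orient b x y - H b * orient a x y + H x * orient a b y - H y * orient a b x = 0)
    (hx : 0 ≤ orient c e x) (ha : 0 ≤ orient c e a) (hb : 0 ≤ orient c e b)
    (hy : 0 ≤ orient c e y) (hxy : orient a b x * orient a b y < 0) : False := by
  have h := orient_relation a b x y (orientAffine c e)
  simp only [orientAffine_apply] at h
  rw [hH, hH, hH, hH, abs_of_nonneg hx, abs_of_nonneg ha, abs_of_nonneg hb, abs_of_nonneg hy,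
    orient_self_outer, orient_self_right, abs_zero] at hrel
  -- The four points lie on one side of the line `c e`, so that term is affine on them and drops
  -- out.
  have key : α * (|orient a b x| * orient a b y - |orient a b y| * orient a b x) = 0 := by
    linear_combination hrel - β * h
  have key' := (mul_eq_zero.1 key).resolve_left hα.ne'
  rcases mul_neg_iff.1 hxy with ⟨h1, h2⟩ | ⟨h1, h2⟩
  · rw [abs_of_pos h1, abs_of_neg h2] at key'; nlinarith
  · rw [abs_of_neg h1, abs_of_pos h2] at key'; nlinarith

/-- The sum of two functions bent along the crossing diagonals `a b` and `c e` is not affine on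
`a`, `x`, `c`, `b`, if `x` lies on the same side of `a b` as `c` and of `c e` as `a`. -/
theorem relation_ne_zero_of_crossing {a b c e x : Fin 2 → ℝ} {α β : ℝ} (hβ : 0 < β)
    {H : (Fin 2 → ℝ) → ℝ} (hH : ∀ z, H z = α * |orient a b z| + β * |orient c e z|)
    (hrel : H a * orient x c b - H x * orient a c b + H c * orient a x b - H b * orient a x c = 0)
    (hxc : 0 < orient a b x * orient a b c) (hxa : 0 < orient c e x * orient c e a)
    (hab : orient c e a * orient c e b < 0) (hne : orient a x c ≠ 0) : False := by
  have h1 := orient_relation a x c b (orientAffine a b)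
  have h2 := orient_relation a x c b (orientAffine c e)
  simp only [orientAffine_apply, orient_self_outer, orient_self_right] at h1 h2
  rw [hH, hH, hH, hH, orient_self_outer a b, orient_self_right a b, orient_self_outer c e,
    abs_zero] at hrel
  -- The points `a`, `x`, `c`, `b` lie on one closed side of `a b`, so the first term drops out. The
  -- line `c e` has only `b` on the side opposite to `a`, so the second term departs from an affine
  -- function at `b` alone.
  have key : β * (orient c e b * orient a x c) = 0 := by
    rcases mul_pos_iff.1 hxc with ⟨i1, i2⟩ | ⟨i1, i2⟩ <;>
    rcases mul_pos_iff.1 hxa with ⟨j1, j2⟩ | ⟨j1, j2⟩ <;>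
    rcases mul_neg_iff.1 hab with ⟨k1, k2⟩ | ⟨k1, k2⟩
    · rw [abs_of_pos i1, abs_of_pos i2, abs_of_pos j1, abs_of_pos j2, abs_of_neg k2] at hrel
      linear_combination (hrel - α * h1 - β * h2) / 2
    · linarith
    · linarith
    · rw [abs_of_pos i1, abs_of_pos i2, abs_of_neg j1, abs_of_neg j2, abs_of_pos k2] at hrel
      linear_combination -(hrel - α * h1 + β * h2) / 2
    · rw [abs_of_neg i1, abs_of_neg i2, abs_of_pos j1, abs_of_pos j2, abs_of_neg k2] at hrel
      linear_combination (hrel + α * h1 - β * h2) / 2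
    · linarith
    · linarith
    · rw [abs_of_neg i1, abs_of_neg i2, abs_of_neg j1, abs_of_neg j2, abs_of_pos k2] at hrel
      linear_combination -(hrel + α * h1 + β * h2) / 2
  have hb : orient c e b ≠ 0 := by rintro h; rw [h] at hab; simp at hab
  exact mul_ne_zero hβ.ne' (mul_ne_zero hb hne) key

namespace IsCcw

variable {n : ℕ} {p : Fin (n + 3) → Fin 2 → ℝ}

theorem orient_ne_zero (hp : IsCcw p) {a b x : Fin (n + 3)} (hab : a ≠ b) (hxa : x ≠ a)
    (hxb : x ≠ b) : orient (p a) (p b) (p x) ≠ 0 := by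
  wlog hlt : a < b generalizing a b
  · rw [orient_swap_left]
    exact neg_ne_zero.2 (this hab.symm hxb hxa (lt_of_le_of_ne (not_lt.1 hlt) hab.symm))
  rcases lt_or_gt_of_ne hxa with h | h
  · exact (hp.orient_pos hlt (Or.inl h)).ne'
  rcases lt_or_gt_of_ne hxb with h' | h'
  · exact (hp.orient_neg h h').ne
  · exact (hp.orient_pos hlt (Or.inr h')).ne'

/-- A vertex `x` other than the four ends exists because `2 ≤ n`. Exchanging the ends of the
diagonals, which does not affect absolute values, brings `x` to the required side of each. -/
theorem not_relation_of_crossing (hp : IsCcw p) (hn : 2 ≤ n) {a b c e : Fin (n + 3)}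
    (hac : a < c) (hcb : c < b) (hbe : b < e) {α β : ℝ} (hβ : 0 < β)
    {H : (Fin 2 → ℝ) → ℝ}
    (hH : ∀ z, H z = α * |orient (p a) (p b) z| + β * |orient (p c) (p e) z|)
    (hrel : ∀ i j k l, H (p i) * orient (p j) (p k) (p l) - H (p j) * orient (p i) (p k) (p l) +
      H (p k) * orient (p i) (p j) (p l) - H (p l) * orient (p i) (p j) (p k) = 0) : False := by
  obtain ⟨x, hxa, hxb, hxc, hxe⟩ : ∃ x, x ≠ a ∧ x ≠ b ∧ x ≠ c ∧ x ≠ e := by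
    have : ∃ x ∈ (Finset.univ : Finset (Fin (n + 3))), x ∉ ({a, b, c, e} : Finset _) :=
      Finset.exists_mem_notMem_of_card_lt_card (by
        refine lt_of_le_of_lt (Finset.card_le_four) ?_
        rw [Finset.card_univ, Fintype.card_fin]; omega)
    obtain ⟨x, _, hx⟩ := this
    exact ⟨x, by simpa using hx⟩
  have hab := hac.trans hcb
  have hce := hcb.trans hbe
  have sc := hp.orient_neg hac hcb
  have se := hp.orient_pos hab (Or.inr hbe)
  have sa := hp.orient_pos hce (Or.inl hac)
  have sb := hp.orient_neg hcb hbe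
  have habs : ∀ u v z : Fin 2 → ℝ, |orient v u z| = |orient u v z| := fun u v z => by
    rw [orient_swap_left, abs_neg]
  have h0ab := hp.orient_ne_zero hab.ne hxa hxb
  have h0ce := hp.orient_ne_zero hce.ne hxc hxe
  rcases lt_or_gt_of_ne h0ab with h1 | h1 <;> rcases lt_or_gt_of_ne h0ce with h2 | h2
  · refine relation_ne_zero_of_crossing (a := p b) (b := p a) (c := p c) (e := p e) (x := p x) hβ
      (fun z => by rw [hH, habs]) (hrel _ _ _ _) ?_ (mul_pos_of_neg_of_neg h2 sb)
      (mul_neg_of_neg_of_pos sb sa) (hp.orient_ne_zero hxb.symm hcb.ne hxc.symm)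
    rw [orient_swap_left (p a), orient_swap_left (p a), neg_mul_neg]
    exact mul_pos_of_neg_of_neg h1 sc
  · exact relation_ne_zero_of_crossing (a := p a) (b := p b) (c := p c) (e := p e) (x := p x) hβ
      hH (hrel _ _ _ _) (mul_pos_of_neg_of_neg h1 sc) (mul_pos h2 sa)
      (mul_neg_of_pos_of_neg sa sb) (hp.orient_ne_zero hxa.symm hac.ne' hxc.symm)
  · refine relation_ne_zero_of_crossing (a := p b) (b := p a) (c := p e) (e := p c) (x := p x) hβ
      (fun z => by rw [hH, habs, habs (p c)]) (hrel _ _ _ _) ?_ ?_ ?_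
      (hp.orient_ne_zero hxb.symm hbe.ne' hxe.symm)
    · rw [orient_swap_left (p a), orient_swap_left (p a), neg_mul_neg]
      exact mul_pos h1 se
    · rw [orient_swap_left (p c), orient_swap_left (p c), neg_mul_neg]
      exact mul_pos_of_neg_of_neg h2 sb
    · rw [orient_swap_left (p c), orient_swap_left (p c), neg_mul_neg]
      exact mul_neg_of_neg_of_pos sb sa
  · refine relation_ne_zero_of_crossing (a := p a) (b := p b) (c := p e) (e := p c) (x := p x) hβ
      (fun z => by rw [hH, habs (p c)]) (hrel _ _ _ _) (mul_pos h1 se) ?_ ?_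
      (hp.orient_ne_zero hxa.symm (hab.trans hbe).ne' hxe.symm)
    · rw [orient_swap_left (p c), orient_swap_left (p c), neg_mul_neg]
      exact mul_pos h2 sa
    · rw [orient_swap_left (p c), orient_swap_left (p c), neg_mul_neg]
      exact mul_neg_of_pos_of_neg sa sb

/-- If the diagonals differ, an end of `c e` lies strictly inside `a b`; together with `a`, `b` and
the outer vertex `y` it forms a quadrilateral cut by `a b` but not by `c e`. -/
theorem not_relation_of_nested (hp : IsCcw p) {a b c e : Fin (n + 3)} (hab : a < b) (hce : c < e)
    (hac : a ≤ c) (heb : e ≤ b) {x₀ y : Fin (n + 3)} (hx₀ : a < x₀ ∧ x₀ < b) (hy : y < a ∨ b < y)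
    {α β : ℝ} (hα : 0 < α) (hβ : 0 < β) {H : (Fin 2 → ℝ) → ℝ}
    (hH : ∀ z, H z = α * |orient (p a) (p b) z| + β * |orient (p c) (p e) z|)
    (hrel : ∀ i j k l, H (p i) * orient (p j) (p k) (p l) - H (p j) * orient (p i) (p k) (p l) +
      H (p k) * orient (p i) (p j) (p l) - H (p l) * orient (p i) (p j) (p k) = 0) : False := by
  have hy' := hp.orient_pos hab hy
  have hcy : 0 ≤ orient (p c) (p e) (p y) :=
    hp.orient_nonneg hce (hy.imp (fun h => (h.trans_le hac).le) fun h => (heb.trans_lt h).le)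
  have hca := hp.orient_nonneg hce (Or.inl hac)
  have hcb := hp.orient_nonneg hce (Or.inr heb)
  rcases hac.eq_or_lt with rfl | hac
  · rcases heb.eq_or_lt with rfl | heb
    -- For equal diagonals the coefficients merge into `α + β`. The second line is replaced by a
    -- degenerate one with coefficient zero, and `x₀` is the inner vertex.
    · refine relation_ne_zero_of_separated (a := p a) (b := p e) (c := p a) (e := p a)
        (x := p x₀) (y := p y) (α := α + β) (β := 0) (by positivity) (fun z => ?_)
        (hrel _ _ _ _) ?_ ?_ ?_ ?_ (mul_neg_of_neg_of_pos (hp.orient_neg hx₀.1 hx₀.2) hy')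
      · rw [hH]; ring
      all_goals rw [orient_self_left]
    · refine relation_ne_zero_of_separated (x := p e) (y := p y) hα hH (hrel _ _ _ _) ?_
        hca hcb hcy (mul_neg_of_neg_of_pos (hp.orient_neg hce heb) hy')
      rw [orient_self_right]
  · refine relation_ne_zero_of_separated (x := p c) (y := p y) hα hH (hrel _ _ _ _) ?_
        hca hcb hcy (mul_neg_of_neg_of_pos (hp.orient_neg hac (hce.trans_le heb)) hy')
    rw [orient_self_outer]

/-- The vertices `a`, `y`, `b`, `e` lie on one closed side of `c e`, while `a b` separates `y` from
`e`. -/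
theorem not_relation_of_disjoint (hp : IsCcw p) {a b c e : Fin (n + 3)} (hce : c < e)
    (hbc : b ≤ c) {y : Fin (n + 3)} (hy : a < y ∧ y < b)
    {α β : ℝ} (hα : 0 < α) {H : (Fin 2 → ℝ) → ℝ}
    (hH : ∀ z, H z = α * |orient (p a) (p b) z| + β * |orient (p c) (p e) z|)
    (hrel : ∀ i j k l, H (p i) * orient (p j) (p k) (p l) - H (p j) * orient (p i) (p k) (p l) +
      H (p k) * orient (p i) (p j) (p l) - H (p l) * orient (p i) (p j) (p k) = 0) : False := by
  have hab := hy.1.trans hy.2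
  refine relation_ne_zero_of_separated (x := p e) (y := p y) hα hH (hrel _ _ _ _) ?_
    (hp.orient_nonneg hce (Or.inl (hab.le.trans hbc))) (hp.orient_nonneg hce (Or.inl hbc))
    (hp.orient_nonneg hce (Or.inl (hy.2.le.trans hbc)))
    (mul_neg_of_pos_of_neg (hp.orient_pos hab (Or.inr (hbc.trans_lt hce)))
      (hp.orient_neg hy.1 hy.2))
  rw [orient_self_right]

/-- The secondary polytope of a polygon with at least five vertices has no parallel facets. -/
theorem not_hasParallelFacets (hp : IsCcw p) (hn : 2 ≤ n) :
    ¬ HasParallelFacets (secondaryPolytope p) := by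
  rintro ⟨φ, hφ, hmax, hmin⟩
  obtain ⟨a, b, hab, α, r, hα, h1⟩ := hp.exists_eq_bendFunctional hφ hmax
  obtain ⟨c, e, hce, β, s, hβ, h2⟩ := hp.exists_eq_bendFunctional (φ := -φ) (by
    obtain ⟨x, hx, y, hy, hne⟩ := hφ
    exact ⟨x, hx, y, hy, fun h => hne (by simpa using h)⟩) hmin
  obtain ⟨v, hv, v', hv', hne⟩ := hφ
  obtain ⟨⟨x, hx⟩, y, hy⟩ := hp.exists_inside_outside hab ⟨v, hv, v', hv', fun h => hne (by
    rw [h1 v hv, h1 v' hv', h])⟩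
  obtain ⟨⟨x', hx'⟩, y', hy'⟩ := hp.exists_inside_outside hce ⟨v, hv, v', hv', fun h => hne (by
    have e1 := h2 v hv
    have e2 := h2 v' hv'
    rw [h] at e1
    simp only [AffineMap.coe_neg, Pi.neg_apply] at e1 e2
    linarith)⟩
  set F : Fin (n + 3) → ℝ := fun i =>
    α * bend (p a) (p b) (p i) + β * bend (p c) (p e) (p i) with hF
  have hFc : ∀ v ∈ secondaryPolytope p, ∑ i, F i * v i = -r - s := by
    intro v hv
    have e1 := h1 v hv
    have e2 := h2 v hv
    simp only [AffineMap.coe_neg, Pi.neg_apply, bendFunctional_apply] at e1 e2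
    have : ∑ i, F i * v i = α * ∑ i, bend (p a) (p b) (p i) * v i +
        β * ∑ i, bend (p c) (p e) (p i) * v i := by
      simp only [hF, Finset.mul_sum, ← Finset.sum_add_distrib]
      exact Finset.sum_congr rfl fun i _ => by ring
    rw [this]
    linarith
  set H : (Fin 2 → ℝ) → ℝ := fun z =>
    α * |orient (p a) (p b) z| + β * |orient (p c) (p e) z| with hHdef
  -- Up to affine terms a bend is `-1/2` times an absolute value, a form symmetric in the two sides
  -- of the diagonal.
  have hbend : ∀ u v z : Fin 2 → ℝ, |orient u v z| = orient u v z - 2 * bend u v z := by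
    intro u v z
    unfold bend
    rcases le_total (orient u v z) 0 with h | h
    · rw [abs_of_nonpos h, min_eq_left h]; ring
    · rw [abs_of_nonneg h, min_eq_right h]; ring
  have hrel : ∀ i j k l, H (p i) * orient (p j) (p k) (p l) -
      H (p j) * orient (p i) (p k) (p l) + H (p k) * orient (p i) (p j) (p l) -
      H (p l) * orient (p i) (p j) (p k) = 0 := by
    intro i j k l
    have e0 := hp.relation_of_const hFc i j k l
    have e1 := orient_relation (p i) (p j) (p k) (p l) (orientAffine (p a) (p b))
    have e2 := orient_relation (p i) (p j) (p k) (p l) (orientAffine (p c) (p e))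
    simp only [orientAffine_apply] at e1 e2
    simp only [hF] at e0
    simp only [hHdef, hbend]
    linear_combination -2 * e0 + α * e1 + β * e2
  have hH : ∀ z, H z = α * |orient (p a) (p b) z| + β * |orient (p c) (p e) z| := fun z => rfl
  have hH' : ∀ z, H z = β * |orient (p c) (p e) z| + α * |orient (p a) (p b) z| := fun z =>
    add_comm _ _
  rcases le_or_gt b c with hbc | hcb
  · exact hp.not_relation_of_disjoint hce hbc hx hα hH hrel
  rcases le_or_gt e a with hea | hae
  · exact hp.not_relation_of_disjoint hab hea hx' hβ hH' hrel
  rcases le_or_gt a c with hac | hca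
  · rcases le_or_gt e b with heb | hbe
    · exact hp.not_relation_of_nested hab hce hac heb hx hy hα hβ hH hrel
    · rcases hac.eq_or_lt with rfl | hac
      · exact hp.not_relation_of_nested hce hab le_rfl hbe.le hx' hy' hβ hα hH' hrel
      · exact hp.not_relation_of_crossing hn hac hcb hbe hβ hH hrel
  · rcases le_or_gt b e with hbe | heb
    · exact hp.not_relation_of_nested hce hab hca.le hbe hx' hy' hβ hα hH' hrel
    · exact hp.not_relation_of_crossing hn hca hae heb hα hH' hrel

end IsCcw

/-! ### Affine invariance of parallel facets -/

/-- By convexity the multiples of differences of points of `A` form a subspace, on which the linear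
part of `f` is injective. A linear left inverse there, suitably translated, inverts `f` on `A`. -/
theorem exists_affine_leftInverse {E F : Type*} [AddCommGroup E] [Module ℝ E] [AddCommGroup F]
    [Module ℝ F] {A : Set E} (hA : Convex ℝ A) (f : E →ᵃ[ℝ] F) (hf : Set.InjOn f A) :
    ∃ g : F →ᵃ[ℝ] E, ∀ x ∈ A, g (f x) = x := by
  rcases A.eq_empty_or_nonempty with rfl | ⟨x₀, hx₀⟩
  · exact ⟨0, by simp⟩
  let V : Submodule ℝ E :=
    { carrier := {v | ∃ c : ℝ, 0 ≤ c ∧ ∃ x ∈ A, ∃ y ∈ A, v = c • (x - y)}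
      zero_mem' := ⟨0, le_rfl, x₀, hx₀, x₀, hx₀, by simp⟩
      add_mem' := by
        rintro _ _ ⟨c, hc, x, hx, y, hy, rfl⟩ ⟨d, hd, z, hz, w, hw, rfl⟩
        rcases (add_nonneg hc hd).eq_or_lt with h | h
        · have hc0 : c = 0 := by linarith
          have hd0 : d = 0 := by linarith
          exact ⟨0, le_rfl, x₀, hx₀, x₀, hx₀, by simp [hc0, hd0]⟩
        · have hsum : c / (c + d) + d / (c + d) = 1 := by field_simp
          refine ⟨c + d, h.le, _, hA hx hz (by positivity) (by positivity) hsum, _,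
            hA hy hw (by positivity) (by positivity) hsum, ?_⟩
          have e1 : (c + d) * (c / (c + d)) = c := by field_simp
          have e2 : (c + d) * (d / (c + d)) = d := by field_simp
          simp only [smul_sub, smul_add, smul_smul, e1, e2]
          abel
      smul_mem' := by
        rintro r _ ⟨c, hc, x, hx, y, hy, rfl⟩
        rcases le_total 0 r with hr | hr
        · exact ⟨r * c, mul_nonneg hr hc, x, hx, y, hy, by rw [smul_smul]⟩
        · refine ⟨-r * c, mul_nonneg (neg_nonneg.2 hr) hc, y, hy, x, hx, ?_⟩
          rw [smul_smul, ← neg_sub x y, smul_neg, neg_mul, neg_smul, neg_neg] }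
  have hinj : LinearMap.ker (f.linear ∘ₗ V.subtype) = ⊥ := by
    rw [LinearMap.ker_eq_bot']
    rintro ⟨_, c, hc, x, hx, y, hy, rfl⟩ h
    apply Subtype.ext
    simp only [LinearMap.comp_apply, Submodule.subtype_apply, map_smul] at h
    rcases hc.eq_or_lt with rfl | hc
    · simp
    · have h1 := (smul_eq_zero.1 h).resolve_left hc.ne'
      have h2 := f.linearMap_vsub x y
      rw [vsub_eq_sub, vsub_eq_sub, h1] at h2
      have : x = y := hf hx hy (sub_eq_zero.1 h2.symm)
      simp [this]
  obtain ⟨g, hg⟩ := LinearMap.exists_leftInverse_of_injective _ hinj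
  refine ⟨(V.subtype ∘ₗ g).toAffineMap +
    AffineMap.const ℝ F (x₀ - V.subtype (g (f x₀))), fun x hx => ?_⟩
  have hmem : x - x₀ ∈ V := ⟨1, zero_le_one, x, hx, x₀, hx₀, by simp⟩
  have h1 : g (f x - f x₀) = ⟨x - x₀, hmem⟩ := by
    have h2 := f.linearMap_vsub x x₀
    rw [vsub_eq_sub, vsub_eq_sub] at h2
    rw [← h2]
    exact LinearMap.congr_fun hg ⟨x - x₀, hmem⟩
  have h3 : (g (f x) : E) - g (f x₀) = x - x₀ := by
    have := congrArg Subtype.val h1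
    rwa [map_sub, Submodule.coe_sub] at this
  simp only [AffineMap.coe_add, Pi.add_apply, LinearMap.coe_toAffineMap, LinearMap.comp_apply,
    Submodule.subtype_apply, AffineMap.const_apply]
  rw [← sub_eq_zero, show (g (f x) : E) + (x₀ - g (f x₀)) - x =
    ((g (f x) : E) - g (f x₀)) - (x - x₀) by abel, h3, sub_self]

/-- Functionals on `A` are carried to `P` by the affine left inverse of `f`. -/
theorem IsFacetFunctional.of_bijOn {E F : Type*} [AddCommGroup E] [Module ℝ E] [AddCommGroup F]
    [Module ℝ F] {A : Set E} {P : Set F} (hA : Convex ℝ A) {f : E →ᵃ[ℝ] F} (hf : Set.BijOn f A P)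
    {φ : F →ᵃ[ℝ] ℝ} (h : IsFacetFunctional P φ) : IsFacetFunctional A (φ.comp f) := by
  obtain ⟨g, hg⟩ := exists_affine_leftInverse hA f hf.injOn
  rintro u ⟨c, hc⟩
  obtain ⟨a, b, hab⟩ := h (u.comp g) ⟨c, fun x hx hmax => by
    obtain ⟨z, hz, rfl⟩ := hf.surjOn hx
    rw [AffineMap.comp_apply, hg z hz]
    exact hc z hz fun y hy => hmax _ (hf.mapsTo hy)⟩
  refine ⟨a, b, fun x hx => ?_⟩
  have := hab _ (hf.mapsTo hx)
  rwa [AffineMap.comp_apply, hg x hx] at this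

theorem HasParallelFacets.of_affinelyEquivalent {E F : Type*} [AddCommGroup E] [Module ℝ E]
    [AddCommGroup F] [Module ℝ F] {A : Set E} {P : Set F} (hA : Convex ℝ A)
    (hAP : AffinelyEquivalent A P) (h : HasParallelFacets P) : HasParallelFacets A := by
  obtain ⟨f, hf⟩ := hAP
  obtain ⟨φ, ⟨x, hx, y, hy, hne⟩, h1, h2⟩ := h
  refine ⟨φ.comp f, ?_, h1.of_bijOn hA hf, ?_⟩
  · obtain ⟨x', hx', rfl⟩ := hf.surjOn hx
    obtain ⟨y', hy', rfl⟩ := hf.surjOn hy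
    exact ⟨x', hx', y', hy', hne⟩
  · have : -(φ.comp f) = (-φ).comp f := by ext; simp
    rw [this]
    exact h2.of_bijOn hA hf

/-! ### Associahedra of type III -/

theorem convexHull_single_bounds {n : ℕ} {i j : Fin (n + 1)} (w : Fin (n + 1) → ℝ) {c : ℝ}
    (hw : ∀ k, i ≤ k → k ≤ j → w k ≤ c) {x : Fin (n + 1) → ℝ}
    (hx : x ∈ convexHull ℝ
      ((fun k : Fin (n + 1) => (Pi.single k 1 : Fin (n + 1) → ℝ)) '' Set.Icc i j)) :
    w ⬝ᵥ x ≤ c := by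
  refine convexHull_min (t := {x | w ⬝ᵥ x ≤ c}) ?_ ?_ hx
  · rintro _ ⟨k, hk, rfl⟩
    simpa using hw k hk.1 hk.2
  · exact convex_halfSpace_le ⟨fun x y => dotProduct_add _ _ _, fun c x => by simp⟩ _

theorem dotProduct_le_of_mem_assIII {n : ℕ} {a : Fin (n + 1) → Fin (n + 1) → ℝ}
    (ha : ∀ i j, i ≤ j → 0 < a i j) (w : Fin (n + 1) → ℝ) {c : Fin (n + 1) → Fin (n + 1) → ℝ}
    (hw : ∀ i j k, i ≤ k → k ≤ j → w k ≤ c i j) {x : Fin (n + 1) → ℝ} (hx : x ∈ assIII n a) :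
    w ⬝ᵥ x ≤ ∑ i, ∑ j ∈ Finset.Ici i, a i j * c i j := by
  obtain ⟨y, hy, rfl⟩ := Set.mem_finsetSum _ _ _ |>.1 hx
  rw [dotProduct_sum]
  refine Finset.sum_le_sum fun i _ => ?_
  obtain ⟨z, hz, hzy⟩ := Set.mem_finsetSum _ _ _ |>.1 (hy (Finset.mem_univ i))
  rw [← hzy, dotProduct_sum]
  refine Finset.sum_le_sum fun j hj => ?_
  obtain ⟨v, hv, hvz⟩ := hz hj
  rw [← hvz]
  simp only [dotProduct_smul, smul_eq_mul]
  exact mul_le_mul_of_nonneg_left (convexHull_single_bounds w (hw i j) hv)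
    (ha i j (Finset.mem_Ici.1 hj)).le

theorem pick_mem_assIII {n : ℕ} (a : Fin (n + 1) → Fin (n + 1) → ℝ)
    (f : Fin (n + 1) → Fin (n + 1) → Fin (n + 1)) (hf : ∀ i j, i ≤ j → i ≤ f i j ∧ f i j ≤ j) :
    ∑ i, ∑ j ∈ Finset.Ici i, a i j • (Pi.single (f i j) 1 : Fin (n + 1) → ℝ) ∈ assIII n a := by
  refine Set.finsetSum_mem_finsetSum _ _ _ fun i _ => ?_
  refine Set.finsetSum_mem_finsetSum _ _ _ fun j hj => ?_
  exact Set.smul_mem_smul_set (subset_convexHull ℝ _ ⟨f i j, hf i j (Finset.mem_Ici.1 hj), rfl⟩)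

theorem dotProduct_pick {n : ℕ} (a : Fin (n + 1) → Fin (n + 1) → ℝ)
    (f : Fin (n + 1) → Fin (n + 1) → Fin (n + 1)) (w : Fin (n + 1) → ℝ) :
    w ⬝ᵥ ∑ i, ∑ j ∈ Finset.Ici i, a i j • (Pi.single (f i j) 1 : Fin (n + 1) → ℝ) =
      ∑ i, ∑ j ∈ Finset.Ici i, a i j * w (f i j) := by
  simp [dotProduct_sum]

theorem affine_eq_dotProduct {ι : Type*} [Fintype ι] (u : (ι → ℝ) →ᵃ[ℝ] ℝ) :
    ∃ (w : ι → ℝ) (c : ℝ), ∀ x, u x = w ⬝ᵥ x + c := by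
  classical
  refine ⟨fun i => u.linear (Pi.single i 1), u 0, fun x => ?_⟩
  have h1 : u x = u.linear x + u 0 := by
    have := u.map_vadd 0 x
    simpa using this
  rw [h1, LinearMap.pi_apply_eq_sum_univ u.linear x]
  congr 1
  refine Finset.sum_congr rfl fun i _ => ?_
  rw [smul_eq_mul, mul_comm]
  congr 2
  ext j
  simp [Pi.single_apply, eq_comm]

/-- The linear functional `x ↦ w ⬝ᵥ x`, as an affine map. -/
def dotAffine {ι : Type*} [Fintype ι] (w : ι → ℝ) : (ι → ℝ) →ᵃ[ℝ] ℝ :=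
  (dotProductBilin ℝ ℝ w).toAffineMap

@[simp]
theorem dotAffine_apply {ι : Type*} [Fintype ι] (w x : ι → ℝ) : dotAffine w x = w ⬝ᵥ x := rfl

/-- If `f` picks, for all `i ≤ j`, an index in `[i, j]` maximizing `w`, then the maximal face of `w`
is a facet as soon as `w` is constant on the indices different from `0`. -/
theorem isFacetFunctional_assIII {n : ℕ} (hn : 1 ≤ n) {a : Fin (n + 1) → Fin (n + 1) → ℝ}
    (ha : ∀ i j, i ≤ j → 0 < a i j) {s : ℝ} (hs : s ≠ 0)
    {f : Fin (n + 1) → Fin (n + 1) → Fin (n + 1)} (hf : ∀ i j, i ≤ j → i ≤ f i j ∧ f i j ≤ j)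
    (hmax : ∀ i j k, i ≤ k → k ≤ j → (Pi.single 0 s : Fin (n + 1) → ℝ) k ≤
      (Pi.single 0 s : Fin (n + 1) → ℝ) (f i j)) :
    IsFacetFunctional (assIII n a) (dotAffine (Pi.single 0 s)) := by
  rintro u ⟨c, hc⟩
  obtain ⟨w, d, hw⟩ := affine_eq_dotProduct u
  have h10 : (1 : Fin (n + 1)) ≠ 0 := by
    rw [Ne, Fin.ext_iff]
    simp
    omega
  have hpick : ∀ k, k ≠ 0 → w k = w 1 := by
    -- Changing the point picked in the simplex `conv {e_1, …, e_n}` alone stays on the maximal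
    -- face, since the functional vanishes on that simplex. As `a 1 n` is positive, this forces `w k
    -- = w 1`.
    let g : Fin (n + 1) → Fin (n + 1) → Fin (n + 1) → Fin (n + 1) := fun k i j =>
      if i = 1 ∧ j = Fin.last n then k else f i j
    have key : ∀ k, k ≠ 0 →
        w ⬝ᵥ (∑ i, ∑ j ∈ Finset.Ici i, a i j • (Pi.single (g k i j) 1 : Fin (n + 1) → ℝ)) + d =
          c := by
      intro k hk
      rw [← hw]
      refine hc _ (pick_mem_assIII a _ fun i j hij => ?_) fun y hy => ?_
      · simp only [g]
        split_ifs with h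
        · rw [h.1, h.2]
          refine ⟨?_, Fin.le_last k⟩
          have := Fin.val_ne_zero_iff.2 hk
          have : (1 : Fin (n + 1)).val ≤ 1 := by rw [Fin.val_one']; exact Nat.mod_le _ _
          rw [Fin.le_def]
          omega
        · exact hf i j hij
      · rw [dotAffine_apply, dotAffine_apply, dotProduct_pick]
        refine dotProduct_le_of_mem_assIII ha _ (fun i j l hil hlj => ?_) hy
        simp only [g]
        split_ifs with h
        · have hl : l ≠ 0 := by
            rintro rfl
            rw [h.1] at hil
            exact h10 (le_antisymm hil (Fin.zero_le _))
          rw [Pi.single_eq_of_ne hl, Pi.single_eq_of_ne hk]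
        · exact hmax i j l hil hlj
    have hval : ∀ k, w ⬝ᵥ (∑ i, ∑ j ∈ Finset.Ici i,
        a i j • (Pi.single (g k i j) 1 : Fin (n + 1) → ℝ)) =
        a 1 (Fin.last n) * w k + ∑ i, ∑ j ∈ Finset.Ici i,
          if i = 1 ∧ j = Fin.last n then 0 else a i j * w (f i j) := by
      intro k
      have hsplit : ∀ i j, a i j * w (g k i j) =
          (if i = 1 ∧ j = Fin.last n then a i j * w k else 0) +
            if i = 1 ∧ j = Fin.last n then 0 else a i j * w (f i j) := by
        intro i j
        simp only [g]
        split_ifs <;> simp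
      rw [dotProduct_pick]
      simp only [hsplit, Finset.sum_add_distrib]
      congr 1
      rw [Finset.sum_eq_single 1, Finset.sum_eq_single (Fin.last n)]
      · simp
      · intro j _ hj; simp [hj]
      · intro h; exact absurd (Finset.mem_Ici.2 (Fin.le_last _)) h
      · intro i _ hi; simp [hi]
      · simp
    intro k hk
    have e1 := key k hk
    have e2 := key 1 h10
    rw [hval] at e1 e2
    have := ha 1 (Fin.last n) (Fin.le_last _)
    exact mul_left_cancel₀ this.ne' (by linarith)
  -- The coordinate sum is constant, so `w 1` times the sum contributes a constant and only the
  -- dependence on `x 0` remains.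
  have htotal : ∃ T, ∀ x ∈ assIII n a, ∑ i, x i = T := by
    refine ⟨∑ i, ∑ j ∈ Finset.Ici i, a i j * 1, fun x hx => le_antisymm ?_ ?_⟩
    · have := dotProduct_le_of_mem_assIII ha (fun _ => 1) (c := fun _ _ => 1) (by simp) hx
      simpa [dotProduct] using this
    · have := dotProduct_le_of_mem_assIII ha (fun _ => -1) (c := fun _ _ => -1) (by simp) hx
      simp [dotProduct] at this
      simpa using this
  obtain ⟨T, hT⟩ := htotal
  refine ⟨(w 0 - w 1) / s, w 1 * T + d, fun x hx => ?_⟩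
  rw [hw, dotAffine_apply, single_dotProduct, ← mul_assoc, div_mul_cancel₀ _ hs, ← hT x hx]
  have : w ⬝ᵥ x = ∑ i, ((if i = 0 then (w 0 - w 1) * x 0 else 0) + w 1 * x i) := by
    refine Finset.sum_congr rfl fun i _ => ?_
    split_ifs with h
    · subst h; ring
    · rw [hpick i h]; ring
  rw [this, Finset.sum_add_distrib, ← Finset.mul_sum]
  simp
  ring

/-- The coordinate `x 0` is maximized by picking the first index of each interval and minimized by
picking the last. -/
theorem hasParallelFacets_assIII {n : ℕ} (hn : 1 ≤ n) {a : Fin (n + 1) → Fin (n + 1) → ℝ}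
    (ha : ∀ i j, i ≤ j → 0 < a i j) : HasParallelFacets (assIII n a) := by
  have h10 : (1 : Fin (n + 1)) ≠ 0 := by
    rw [Ne, Fin.ext_iff]
    simp
    omega
  have hl0 : Fin.last n ≠ 0 := by
    rw [Ne, Fin.ext_iff]
    simp
    omega
  refine ⟨dotAffine (Pi.single 0 1), ?_, ?_, ?_⟩
  · refine ⟨_, pick_mem_assIII a (fun i _ => i) fun i j h => ⟨le_rfl, h⟩,
      _, pick_mem_assIII a (fun _ j => j) fun i j h => ⟨h, le_rfl⟩, ?_⟩
    rw [dotAffine_apply, dotAffine_apply, dotProduct_pick, dotProduct_pick]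
    apply ne_of_gt
    refine Finset.sum_lt_sum (fun i _ => Finset.sum_le_sum fun j hj => ?_)
      ⟨0, Finset.mem_univ _, Finset.sum_lt_sum (fun j hj => ?_)
        ⟨Fin.last n, by simp, ?_⟩⟩
    · have hij := Finset.mem_Ici.1 hj
      refine mul_le_mul_of_nonneg_left ?_ (ha i j hij).le
      by_cases hj0 : j = 0
      · subst hj0
        rw [le_antisymm hij (Fin.zero_le i)]
      · rw [Pi.single_eq_of_ne hj0]
        by_cases hi0 : i = 0
        · simp [hi0]
        · simp [Pi.single_eq_of_ne hi0]
    · refine mul_le_mul_of_nonneg_left ?_ (ha 0 j (Fin.zero_le j)).le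
      by_cases hj0 : j = 0
      · simp [hj0]
      · simp [Pi.single_eq_of_ne hj0]
    · simp [Pi.single_eq_of_ne hl0, ha 0 (Fin.last n) (Fin.zero_le _)]
  · refine isFacetFunctional_assIII hn ha one_ne_zero (f := fun i _ => i)
      (fun i j h => ⟨le_rfl, h⟩) fun i j k hik hkj => ?_
    by_cases hk : k = 0
    · subst hk; rw [le_antisymm hik (Fin.zero_le i)]
    · rw [Pi.single_eq_of_ne hk]
      by_cases hi0 : i = 0
      · simp [hi0]
      · simp [Pi.single_eq_of_ne hi0]
  · have : -dotAffine (Pi.single 0 1 : Fin (n + 1) → ℝ) = dotAffine (Pi.single 0 (-1)) := by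
      refine AffineMap.ext fun x => ?_
      simp
    rw [this]
    refine isFacetFunctional_assIII hn ha (by norm_num) (f := fun _ j => j)
      (fun i j h => ⟨h, le_rfl⟩) fun i j k hik hkj => ?_
    by_cases hj : j = 0
    · subst hj; rw [le_antisymm hkj (Fin.zero_le k)]
    · rw [Pi.single_eq_of_ne hj]
      by_cases hk : k = 0
      · simp [hk]
      · simp [Pi.single_eq_of_ne hk]

/-! ### Simple root coordinates and clusters -/

/-- The `k`-th coordinate of a vector of the root space in the basis of simple roots. -/
def simpleCoord (n : ℕ) (k : Fin n) : (Fin (n + 1) → ℝ) →ₗ[ℝ] ℝ :=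
  ∑ i ∈ Finset.Iic k.castSucc, LinearMap.proj i

theorem simpleCoord_apply {n : ℕ} (k : Fin n) (y : Fin (n + 1) → ℝ) :
    simpleCoord n k y = ∑ i ∈ Finset.Iic k.castSucc, y i := by
  simp [simpleCoord]

theorem simpleCoord_simpleRoot {n : ℕ} (k l : Fin n) :
    simpleCoord n k (simpleRoot n l) = if k = l then 1 else 0 := by
  rw [simpleCoord_apply]
  simp only [simpleRoot, Pi.sub_apply, Finset.sum_sub_distrib]
  rcases lt_trichotomy k l with h | rfl | h
  · simp [h.ne, not_le.2 h, not_lt.2 h.le]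
  · simp
  · simp [h.ne', h, h.le]

theorem simpleRoot_mem_rootSpace {n : ℕ} (k : Fin n) : simpleRoot n k ∈ rootSpace n := by
  change ∑ i, simpleRoot n k i = 0
  simp [simpleRoot]

/-- The coordinates are partial sums. If these and the total sum vanish, so does each entry. -/
theorem eq_zero_of_simpleCoord {n : ℕ} {y : Fin (n + 1) → ℝ} (hy : y ∈ rootSpace n)
    (h : ∀ k, simpleCoord n k y = 0) : y = 0 := by
  have hT : ∀ i : Fin (n + 1), ∑ l ∈ Finset.Iic i, y l = 0 := by
    intro i
    induction i using Fin.lastCases with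
    | last =>
      have : Finset.Iic (Fin.last n) = Finset.univ := by ext x; simp [Fin.le_last]
      rw [this]
      exact hy
    | cast k => rw [← simpleCoord_apply]; exact h k
  funext i
  induction i using WellFoundedLT.induction with
  | ind i ih =>
    have h1 := hT i
    rw [← Finset.Iio_insert, Finset.sum_insert (by simp),
      Finset.sum_eq_zero fun l hl => ih l (Finset.mem_Iio.1 hl), add_zero] at h1
    exact h1

theorem simpleCoord_sum_simpleRoot {n : ℕ} (k i j : Fin n) :
    simpleCoord n k (∑ l ∈ Finset.Icc i j, simpleRoot n l) =
      if k ∈ Finset.Icc i j then 1 else 0 := by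
  simp only [map_sum, simpleCoord_simpleRoot, Finset.sum_ite_eq]

/-- The signs force `γ = -α_k` and `β` to be a positive root with `α_k` in its support, so the
diagonal of `β` crosses the snake diagonal of `γ`. -/
theorem not_compatible_of_simpleCoord {n : ℕ} {β γ : Fin (n + 1) → ℝ} {k : Fin n}
    (hβ : 0 < simpleCoord n k β) (hγ : simpleCoord n k γ < 0) : ¬ Compatible n β γ := by
  rintro ⟨D, D', ⟨-, hD⟩, ⟨-, hD'⟩, hcross⟩
  rcases hD with ⟨l, rfl, -⟩ | ⟨i, j, -, rfl, hsnake⟩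
  · rw [map_neg, simpleCoord_simpleRoot] at hβ
    split_ifs at hβ <;> linarith
  rcases hD' with ⟨l, rfl, rfl⟩ | ⟨i', j', -, rfl, -⟩
  · rw [map_neg, simpleCoord_simpleRoot] at hγ
    rw [simpleCoord_sum_simpleRoot] at hβ
    have hkl : k = l := by by_contra h; simp [h] at hγ
    have hk : k ∈ Finset.Icc i j := by by_contra h; simp [h] at hβ
    exact hcross ((hsnake l).2 (hkl ▸ hk))
  · rw [simpleCoord_sum_simpleRoot] at hγ
    split_ifs at hγ <;> linarith

/-- The cone of a cluster is contained in an orthant for the basis of simple roots. -/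
theorem IsCluster.simpleCoord_mul_nonneg {n : ℕ} {C : Set (Fin (n + 1) → ℝ)} (hC : IsCluster n C)
    (k : Fin n) {x y : Fin (n + 1) → ℝ} (hx : x ∈ Submodule.span NNReal C)
    (hy : y ∈ Submodule.span NNReal C) : 0 ≤ simpleCoord n k x * simpleCoord n k y := by
  have hspan : ∀ f : (Fin (n + 1) → ℝ) →ₗ[ℝ] ℝ, (∀ β ∈ C, 0 ≤ f β) →
      ∀ z ∈ Submodule.span NNReal C, 0 ≤ f z := by
    intro f hf z hz
    induction hz using Submodule.span_induction with
    | mem z hz => exact hf z hz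
    | zero => simp
    | add z w _ _ hz hw => rw [map_add]; exact add_nonneg hz hw
    | smul c z _ hz =>
      rw [NNReal.smul_def, map_smul]
      exact mul_nonneg c.2 hz
  -- A root of `C` with negative coordinate excludes any with positive coordinate, so the coordinate
  -- has one sign on `C` and on its cone.
  by_cases hpos : ∀ β ∈ C, 0 ≤ simpleCoord n k β
  · exact mul_nonneg (hspan _ hpos x hx) (hspan _ hpos y hy)
  · push Not at hpos
    obtain ⟨γ, hγ, hγk⟩ := hpos
    have hneg : ∀ β ∈ C, 0 ≤ (-simpleCoord n k) β := by
      intro β hβ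
      by_contra! h
      rw [LinearMap.neg_apply, neg_lt_zero] at h
      exact not_compatible_of_simpleCoord h hγk (hC.prop.2 β hβ γ hγ)
    have h1 := hspan _ hneg x hx
    have h2 := hspan _ hneg y hy
    rw [LinearMap.neg_apply, neg_nonneg] at h1 h2
    exact mul_nonneg_of_nonpos_of_nonpos h1 h2

/-! ### Normal fans and parallel facets in type II -/

section NormalFan

variable {ι : Type*} [Fintype ι] {V : Submodule ℝ (ι → ℝ)} {P : Set (ι → ℝ)}

/-- An exposed face is the hull of the generators it contains. Hence there are only finitely many
normal cones, one for each such set of generators at most. -/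
theorem normalCone_inter_eq {s : Finset (ι → ℝ)} (hP : P = convexHull ℝ (s : Set (ι → ℝ)))
    {F : Set (ι → ℝ)} (hF : F.Nonempty) (hexp : IsExposed ℝ P F) :
    normalCone V P F = normalCone V P (F ∩ s) := by
  obtain ⟨l, hl⟩ := hexp hF
  apply Set.Subset.antisymm
  · exact fun w hw => ⟨hw.1, fun x hx => hw.2 x hx.1⟩
  · refine fun w hw => ⟨hw.1, fun x hx y hy => ?_⟩
    have hx' := hl ▸ hx
    have hsP : (s : Set (ι → ℝ)) ⊆ P := hP ▸ subset_convexHull ℝ _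
    have hface := mem_convexHull_face (S := (s : Set (ι → ℝ))) l.toLinearMap.toAffineMap
      (c := l x) (fun z hz => hx'.2 z (hsP hz)) (hP ▸ hx'.1) rfl
    refine convexHull_min (t := {z | w ⬝ᵥ y ≤ w ⬝ᵥ z}) ?_ ?_ hface
    · rintro z ⟨hz, hzx⟩
      refine hw.2 z ⟨?_, hz⟩ y hy
      rw [hl]
      refine ⟨hsP hz, fun v hv => (hx'.2 v hv).trans (le_of_eq hzx.symm)⟩
    · exact convex_halfSpace_ge ⟨fun x y => dotProduct_add _ _ _, fun c x => by simp⟩ _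

theorem finite_normalFan (hP : IsPolytope P) : (normalFan V P).Finite := by
  obtain ⟨s, -, hs⟩ := hP
  refine (s.finite_toSet.finite_subsets.image (normalCone V P)).subset ?_
  rintro K ⟨F, hF, hexp, rfl⟩
  exact ⟨F ∩ s, Set.inter_subset_right, (normalCone_inter_eq hs hF hexp).symm⟩

end NormalFan

namespace IsAssII

variable {n : ℕ} {P : Set (Fin (n + 1) → ℝ)}

/-- The fan is finite, so each normal cone lies in a maximal one, which is a cluster cone. -/
theorem simpleCoord_mul_nonneg (h : IsAssII n P) {F : Set (Fin (n + 1) → ℝ)} (hF : F.Nonempty)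
    (hexp : IsExposed ℝ P F) (k : Fin n) {x y : Fin (n + 1) → ℝ}
    (hx : x ∈ normalCone (rootSpace n) P F) (hy : y ∈ normalCone (rootSpace n) P F) :
    0 ≤ simpleCoord n k x * simpleCoord n k y := by
  obtain ⟨K, hFK, hK⟩ := (finite_normalFan (V := rootSpace n) h.1).exists_le_maximal
    ⟨F, hF, hexp, rfl⟩
  have hK' : K ∈ {K | Maximal (· ∈ normalFan (rootSpace n) P) K} := hK
  rw [h.2.2] at hK'
  obtain ⟨C, hC, rfl⟩ := hK'
  exact hC.simpleCoord_mul_nonneg k (hFK hx) (hFK hy)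

theorem nonempty (h : IsAssII n P) : P.Nonempty := by
  obtain ⟨s, hs, hP⟩ := h.1
  rw [hP]
  exact hs.to_set.convexHull

/-- If `r` is constant on the face exposed by `w = ±α_k`, both `N • w + r` and `N • w - r` lie in
its normal cone for large `N`, once `r` is projected to the root space. Their coordinates other than
the `k`-th are opposite, yet cannot have opposite signs, so they vanish and `r` is a multiple of
`α_k`. -/
theorem isFacetFunctional (h : IsAssII n P) {k : Fin n} {ε : ℝ} (hε : ε * ε = 1) :
    IsFacetFunctional P (dotAffine (ε • simpleRoot n k)) := by
  rintro u ⟨c, hc⟩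
  obtain ⟨r, d, hr⟩ := affine_eq_dotProduct u
  obtain ⟨s, hs, hP⟩ := h.1
  have hsP : (s : Set (Fin (n + 1) → ℝ)) ⊆ P := hP ▸ subset_convexHull ℝ _
  have hle : ∀ (v : Fin (n + 1) → ℝ) (M : ℝ), (∀ z ∈ s, v ⬝ᵥ z ≤ M) → ∀ z ∈ P, v ⬝ᵥ z ≤ M := by
    intro v M hv z hz
    rw [hP] at hz
    exact convexHull_min (t := {z | v ⬝ᵥ z ≤ M}) hv
      (convex_halfSpace_le ⟨fun x y => dotProduct_add _ _ _, fun c x => by simp⟩ _) hz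
  set w := ε • simpleRoot n k with hw
  have hwV : w ∈ rootSpace n := (rootSpace n).smul_mem _ (simpleRoot_mem_rootSpace k)
  obtain ⟨x₀, hx₀s, hx₀⟩ := s.exists_max_image (fun z => w ⬝ᵥ z) hs
  have hx₀P := hle w _ hx₀
  set F : Set (Fin (n + 1) → ℝ) := {x | x ∈ P ∧ ∀ y ∈ P, w ⬝ᵥ y ≤ w ⬝ᵥ x} with hF
  have hx₀F : x₀ ∈ F := ⟨hsP hx₀s, hx₀P⟩
  have hexp : IsExposed ℝ P F := fun _ =>
    ⟨LinearMap.toContinuousLinearMap (dotProductBilin ℝ ℝ w), rfl⟩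
  -- The projection of `r` to the root space, with the same values on `P`.
  set r₀ : Fin (n + 1) → ℝ := fun i => r i - (∑ j, r j) / (n + 1) with hr₀
  have hr₀V : r₀ ∈ rootSpace n := by
    change ∑ i, r₀ i = 0
    simp only [hr₀, Finset.sum_sub_distrib, Finset.sum_const, Finset.card_univ, Fintype.card_fin,
      nsmul_eq_mul]
    push_cast
    field_simp
    ring
  have hrr₀ : ∀ x ∈ P, r ⬝ᵥ x = r₀ ⬝ᵥ x := by
    intro x hx
    have hx0 : ∑ i, x i = 0 := h.2.1 hx
    simp only [dotProduct, hr₀, sub_mul, Finset.sum_sub_distrib, ← Finset.mul_sum, hx0, mul_zero,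
      sub_zero]
  have hcF : ∀ x ∈ F, r₀ ⬝ᵥ x = c - d := by
    intro x hx
    have := hc x hx.1 hx.2
    rw [hr, hrr₀ x hx.1] at this
    linarith
  set M := w ⬝ᵥ x₀ with hM
  -- A bound for all the ratios at once. Generators on the face have denominator zero and contribute
  -- zero; there the inequality holds because both sides vanish.
  set N : ℝ := ∑ z ∈ s, |r₀ ⬝ᵥ z - (c - d)| / (M - w ⬝ᵥ z) with hN
  have hNle : ∀ z ∈ s, |r₀ ⬝ᵥ z - (c - d)| ≤ N * (M - w ⬝ᵥ z) := by
    intro z hz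
    rcases (hx₀ z hz).eq_or_lt with hzM | hzM
    · have hzF : z ∈ F := ⟨hsP hz, fun y hy => (hx₀P y hy).trans hzM.ge⟩
      rw [hcF z hzF, sub_self, abs_zero, hM, hzM, sub_self, mul_zero]
    · have hpos : 0 < M - w ⬝ᵥ z := sub_pos.2 hzM
      rw [← div_le_iff₀ hpos]
      exact Finset.single_le_sum (f := fun z => |r₀ ⬝ᵥ z - (c - d)| / (M - w ⬝ᵥ z))
        (fun y hy => div_nonneg (abs_nonneg _) (sub_nonneg.2 (hx₀ y hy))) hz
  have hcone : ∀ δ : ℝ, |δ| = 1 → N • w + δ • r₀ ∈ normalCone (rootSpace n) P F := by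
    intro δ hδ
    refine ⟨(rootSpace n).add_mem ((rootSpace n).smul_mem _ hwV)
      ((rootSpace n).smul_mem _ hr₀V), fun x hx y hy => ?_⟩
    have hxM : w ⬝ᵥ x = M := le_antisymm (hx₀P x hx.1) (hx.2 x₀ hx₀F.1)
    have e1 : (N • w + δ • r₀) ⬝ᵥ x = N * M + δ * (c - d) := by
      rw [add_dotProduct, smul_dotProduct N w, smul_dotProduct δ r₀, hxM, hcF x hx, smul_eq_mul,
        smul_eq_mul]
    rw [e1]
    refine hle _ _ (fun z hz => ?_) y hy
    rw [add_dotProduct, smul_dotProduct N w, smul_dotProduct δ r₀, smul_eq_mul, smul_eq_mul]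
    have h1 := hNle z hz
    have h2 := le_abs_self (δ * (r₀ ⬝ᵥ z - (c - d)))
    rw [abs_mul, hδ, one_mul] at h2
    linarith
  have hcoord : ∀ l, l ≠ k → simpleCoord n l r₀ = 0 := by
    intro l hl
    have h1 := h.simpleCoord_mul_nonneg ⟨x₀, hx₀F⟩ hexp l (hcone 1 (by simp))
      (hcone (-1) (by simp))
    simp only [map_add, map_smul, hw, simpleCoord_simpleRoot, if_neg hl, smul_eq_mul, mul_zero,
      zero_add, one_mul] at h1
    nlinarith
  have hr₀eq : r₀ - simpleCoord n k r₀ • simpleRoot n k = 0 := by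
    refine eq_zero_of_simpleCoord ((rootSpace n).sub_mem hr₀V
      ((rootSpace n).smul_mem _ (simpleRoot_mem_rootSpace k))) fun l => ?_
    rw [map_sub, map_smul, simpleCoord_simpleRoot]
    split_ifs with hl
    · subst hl; simp
    · simp [hcoord l hl]
  refine ⟨simpleCoord n k r₀ * ε, d, fun x hx => ?_⟩
  rw [hr, hrr₀ x hx, sub_eq_zero.1 hr₀eq, dotAffine_apply, hw, smul_dotProduct, smul_dotProduct,
    map_smul, simpleCoord_simpleRoot, if_pos rfl]
  simp only [smul_eq_mul, mul_one]
  linear_combination -(simpleCoord n k r₀ * (simpleRoot n k ⬝ᵥ x)) * hε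

theorem hasParallelFacets (h : IsAssII n P) (k : Fin n) : HasParallelFacets P := by
  refine ⟨dotAffine (simpleRoot n k), ?_, ?_, ?_⟩
  · by_contra! hcon
    simp only [dotAffine_apply] at hcon
    -- If `α_k` were constant on `P`, both `α_k` and `-α_k` would lie in the normal cone of `P`
    -- itself, with `k`-th coordinates of opposite sign.
    have h1 := h.simpleCoord_mul_nonneg h.nonempty (IsExposed.refl P) k
      (x := simpleRoot n k) (y := -simpleRoot n k)
      ⟨simpleRoot_mem_rootSpace k, fun x hx y hy => (hcon y hy x hx).le⟩
      ⟨(rootSpace n).neg_mem (simpleRoot_mem_rootSpace k), fun x hx y hy => by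
        rw [neg_dotProduct, neg_dotProduct, hcon y hy x hx]⟩
    rw [map_neg, simpleCoord_simpleRoot, if_pos rfl] at h1
    norm_num at h1
  · have := h.isFacetFunctional (k := k) (ε := 1) (by norm_num)
    rwa [one_smul] at this
  · have := h.isFacetFunctional (k := k) (ε := -1) (by norm_num)
    have he : -dotAffine (simpleRoot n k) = dotAffine (-1 • simpleRoot n k) := by
      refine AffineMap.ext fun x => ?_
      simp
    rw [he]
    convert this using 2
    simp

end IsAssII

theorem theorem4 (n : ℕ) (hn : 2 ≤ n) (q : Fin (n + 3) → Fin 2 → ℝ)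
    (hq : ConvexIndependent ℝ q) :
    (∀ P : Set (Fin (n + 1) → ℝ), IsAssII n P → ¬ AffinelyEquivalent (assI n q) P) ∧
    (∀ a : Fin (n + 1) → Fin (n + 1) → ℝ, (∀ i j, i ≤ j → 0 < a i j) →
      ¬ AffinelyEquivalent (assI n q) (assIII n a)) := by
  obtain ⟨e, he⟩ := hq.exists_isCcw
  have key : ∀ P : Set (Fin (n + 1) → ℝ), HasParallelFacets P →
      ¬ AffinelyEquivalent (assI n q) P := fun P hP hequiv =>
    he.not_hasParallelFacets hn
      (hP.of_affinelyEquivalent (convex_convexHull ℝ _) (hequiv.of_comp e))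
  exact ⟨fun P hP => key P (hP.hasParallelFacets ⟨0, by omega⟩),
    fun a ha => key _ (hasParallelFacets_assIII (by omega) ha)⟩
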